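/- Notation. For functions on $\mathbb R^3$ let $\hat f(\xi)=\int e^{-2\pi i x\cdot\xi}f(x)\,dx$, $\|f\|_{\dot H^s}=\|(2\pi|\xi|)^s\hat f\|_{L^2}$ and $\|f\|_{H^s}^2=\int(1+(2\pi|\xi|)^{2s})|\hat f|^2\,d\xi$ (matrices carry the Frobenius norm). For $s\ge 0$ let $H^s_{st}$ be the space of all matrix fields $\nabla_{sym}(-\Delta)^{-1/2}u$, where $u\in H^s(\mathbb R^3;\mathbb R^3)$, $\xi\cdot\hat u(\xi)=0$ almost everywhere, and $(\nabla_{sym}v)_{ij}=\frac12(\partial_iv_j+\partial_jv_i)$. Put $L^2_{st}=H^0_{st}$ and let $P_{st}$ be the orthogonal projection of $L^2(\mathbb R^3;\mathbb R^{3\times3})$ onto $L^2_{st}$. Let $0<T_{max}\le+\infty$ and let $S\in C([0,T_{max});H^1_{st})$ be a mild solution of the strain self-amplification model equation $\partial_tS-\Delta S+\frac23P_{st}(S^2)=0$ with initial value $S^0=S(0)$, that is, for all $0<t<T_{max}$, $$S(t)=e^{t\Delta}S^0-\frac23\int_0^te^{\tau\Delta}P_{st}\big(S(t-\tau)^2\big)\,d\tau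 .$$ Suppose that $S^0\neq0$ and that $$g_0:=\frac{-3\|S^0\|_{\dot H^1}^2-4\int\det(S^0)}{\|S^0\|_{L^2}^3}\ \ge\ 0 .$$ Then, for all $0\le t<T_{max}$, $S(t)\ne0$ and $\det S(t)$ is integrable; the function $$g(t)=\frac{-3\|S(t)\|_{\dot H^1}^2-4\int\det(S(t))}{\|S(t)\|_{L^2}^3}$$ is nondecreasing on $[0,T_{max})$; and the enstrophy $E(t)=\|S(t)\|_{L^2}^2$ is differentiable on $[0,T_{max})$ (from the right at $t=0$) with $$\partial_tE(t)\ \ge\ g_0\,E(t)^{3/2}\qquad\text{for all }0\le t<T_{max}.$$ -/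

import Mathlib

open MeasureTheory Filter Topology FourierTransform

noncomputable section

namespace StrainModel

/-! ## Fields on `ℝ³` -/

/-- Physical (and frequency) space `ℝ³`. -/
abbrev R3 : Type := EuclideanSpace ℝ (Fin 3)

/-- Real `L²` fields on `ℝ³` with components indexed by `ι`, with the Euclidean norm on values. -/
abbrev L2Field (ι : Type) [Fintype ι] : Type :=
  Lp (EuclideanSpace ℝ ι) 2 (volume : Measure R3)

/-- `L²(ℝ³; ℝ³)`. -/
abbrev VectorField : Type := L2Field (Fin 3)

/-- `L²(ℝ³; ℝ^{3×3})`; the Euclidean norm on `ℝ^{3×3}` is the Frobenius norm. -/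
abbrev MatrixField : Type := L2Field (Fin 3 × Fin 3)

/-- The matrix with the given list of entries. -/
def toMat (v : EuclideanSpace ℝ (Fin 3 × Fin 3)) : Matrix (Fin 3) (Fin 3) ℝ :=
  Matrix.of fun i j => v (i, j)

/-- The list of entries of a matrix. -/
def ofMat (A : Matrix (Fin 3) (Fin 3) ℝ) : EuclideanSpace ℝ (Fin 3 × Fin 3) :=
  WithLp.toLp 2 fun p => A p.1 p.2

/-! ## Fourier transform and Sobolev norms -/

/-- The inclusion `ℝ^ι ⊆ ℂ^ι`. -/
def complexify (ι : Type) [Fintype ι] : EuclideanSpace ℝ ι →L[ℝ] EuclideanSpace ℂ ι :=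
  LinearMap.toContinuousLinearMap
    { toFun := fun v => WithLp.toLp 2 fun i => (v i : ℂ)
      map_add' := fun v w => by ext i; simp
      map_smul' := fun c v => by ext i; simp }

/-- The (Plancherel) Fourier transform of a real `L²` field, componentwise,
with the normalization `f̂(ξ) = ∫ exp(-2πi x·ξ) f(x) dx`. -/
def fourierL2 {ι : Type} [Fintype ι] (f : L2Field ι) :
    Lp (EuclideanSpace ℂ ι) 2 (volume : Measure R3) :=
  𝓕 ((complexify ι).compLp f : Lp (EuclideanSpace ℂ ι) 2 (volume : Measure R3))

/-- The inhomogeneous norm `‖f‖_{H^s} = ‖(1 + (2π|ξ|)^{2s})^{1/2} f̂‖_{L²}` of an `L²` field,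
infinite if `f ∉ H^s`. -/
def sobolevNorm {ι : Type} [Fintype ι] (s : ℝ) (f : L2Field ι) : ENNReal :=
  eLpNorm (fun ξ : R3 =>
    ((1 + (2 * Real.pi * ‖ξ‖) ^ (2 * s)) ^ (1 / 2 : ℝ) : ℝ) • fourierL2 f ξ) 2 volume

/-- The homogeneous norm `‖f‖_{Ḣ^s} = ‖(2π|ξ|)^s f̂‖_{L²}` of an `L²` field for which it is
finite. -/
def homSobolevNorm {ι : Type} [Fintype ι] (s : ℝ) (f : L2Field ι) : ℝ :=
  (eLpNorm (fun ξ : R3 => ((2 * Real.pi * ‖ξ‖) ^ s : ℝ) • fourierL2 f ξ) 2 volume).toReal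

/-! ## Divergence free fields and strain matrices -/

/-- `u ∈ H^s_df` (for `s ≥ 0`): `u ∈ H^s` and `ξ · û(ξ) = 0` almost everywhere. -/
def MemHdf (s : ℝ) (u : VectorField) : Prop :=
  sobolevNorm s u < ⊤ ∧ ∀ᵐ ξ : R3, ∑ i : Fin 3, (ξ i : ℂ) * fourierL2 u ξ i = 0

/-- `S = ∇_sym (-Δ)^{-1/2} u`, that is, `S_ij = (∂_i v_j + ∂_j v_i) / 2` with
`v = (-Δ)^{-1/2} u`; the symbols of `∂_j` and `(-Δ)^{1/2}` are `2πi ξ_j` and `2π|ξ|`. -/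
def IsSymGradRiesz (u : VectorField) (S : MatrixField) : Prop :=
  ∀ i j : Fin 3, ∀ᵐ ξ : R3, fourierL2 S ξ (i, j) =
    (1 / 2 : ℂ) *
      (2 * Real.pi * Complex.I * ξ i * (fourierL2 u ξ j / (2 * Real.pi * ‖ξ‖ : ℝ)) +
        2 * Real.pi * Complex.I * ξ j * (fourierL2 u ξ i / (2 * Real.pi * ‖ξ‖ : ℝ)))

lemma fourierL2_add {ι : Type} [Fintype ι] (f g : L2Field ι) :
    fourierL2 (f + g) = fourierL2 f + fourierL2 g := by
  have h : ((complexify ι).compLp (f + g) : Lp (EuclideanSpace ℂ ι) 2 (volume : Measure R3)) =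
      (complexify ι).compLp f + (complexify ι).compLp g :=
    ((complexify ι).compLpₗ 2 volume).map_add f g
  rw [fourierL2, h]
  exact (Lp.fourierTransformₗᵢ R3 (EuclideanSpace ℂ ι)).map_add _ _

lemma fourierL2_smul {ι : Type} [Fintype ι] (c : ℝ) (f : L2Field ι) :
    fourierL2 (c • f) = (c : ℂ) • fourierL2 f := by
  have h : ((complexify ι).compLp (c • f) : Lp (EuclideanSpace ℂ ι) 2 (volume : Measure R3)) =
      (c : ℂ) • (complexify ι).compLp f := by
    have h1 := ((complexify ι).compLpₗ 2 (volume : Measure R3)).map_smul c f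
    have h1' : ((complexify ι).compLp (c • f) : Lp (EuclideanSpace ℂ ι) 2 (volume : Measure R3)) =
        c • (complexify ι).compLp f := h1
    rw [h1']
    ext1
    filter_upwards [Lp.coeFn_smul c ((complexify ι).compLp f),
      Lp.coeFn_smul (c : ℂ) ((complexify ι).compLp f)] with x h2 h3
    rw [h2, h3]
    ext i
    simp
  rw [fourierL2, h]
  exact (Lp.fourierTransformₗᵢ R3 (EuclideanSpace ℂ ι)).map_smul _ _

lemma fourierL2_zero {ι : Type} [Fintype ι] : fourierL2 (0 : L2Field ι) = 0 := by
  have := fourierL2_smul (0 : ℝ) (0 : L2Field ι)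
  simpa using this

lemma aestronglyMeasurable_weight {ι : Type} [Fintype ι] (s : ℝ) (f : L2Field ι) :
    AEStronglyMeasurable (fun ξ : R3 =>
      ((1 + (2 * Real.pi * ‖ξ‖) ^ (2 * s)) ^ (1 / 2 : ℝ) : ℝ) • fourierL2 f ξ) volume := by
  have h : Measurable fun ξ : R3 =>
      ((1 + (2 * Real.pi * ‖ξ‖) ^ (2 * s)) ^ (1 / 2 : ℝ) : ℝ) := by fun_prop
  exact h.aestronglyMeasurable.smul (Lp.aestronglyMeasurable (fourierL2 f))

lemma MemHdf.zero (s : ℝ) : MemHdf s 0 := by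
  have h0 : (fourierL2 (0 : VectorField) : R3 → EuclideanSpace ℂ (Fin 3)) =ᵐ[volume] 0 := by
    rw [fourierL2_zero]; exact Lp.coeFn_zero _ _ _
  constructor
  · rw [sobolevNorm, eLpNorm_congr_ae (g := 0)]
    · simp
    · filter_upwards [h0] with ξ h
      simp [h]
  · filter_upwards [h0] with ξ h
    simp [h]

lemma MemHdf.add {s : ℝ} {u v : VectorField} (hu : MemHdf s u) (hv : MemHdf s v) :
    MemHdf s (u + v) := by
  have h0 : (fourierL2 (u + v) : R3 → EuclideanSpace ℂ (Fin 3)) =ᵐ[volume]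
      fourierL2 u + fourierL2 v := by
    rw [fourierL2_add]; exact Lp.coeFn_add _ _
  constructor
  · have := eLpNorm_add_lt_top (p := 2) (μ := (volume : Measure R3))
      ⟨aestronglyMeasurable_weight s u, hu.1⟩ ⟨aestronglyMeasurable_weight s v, hv.1⟩
    rw [sobolevNorm]
    refine lt_of_le_of_lt (le_of_eq (eLpNorm_congr_ae ?_)) this
    filter_upwards [h0] with ξ h
    rw [h]
    simp [smul_add]
  · filter_upwards [h0, hu.2, hv.2] with ξ h h1 h2
    rw [h]
    simp only [Pi.add_apply, PiLp.add_apply, mul_add, Finset.sum_add_distrib, h1, h2, add_zero]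

lemma MemHdf.smul {s : ℝ} (c : ℝ) {u : VectorField} (hu : MemHdf s u) : MemHdf s (c • u) := by
  have h0 : (fourierL2 (c • u) : R3 → EuclideanSpace ℂ (Fin 3)) =ᵐ[volume]
      (c : ℂ) • (fourierL2 u : R3 → EuclideanSpace ℂ (Fin 3)) := by
    rw [fourierL2_smul]; exact Lp.coeFn_smul _ _
  constructor
  · have := (MemLp.const_smul (p := 2) (μ := (volume : Measure R3))
      ⟨aestronglyMeasurable_weight s u, hu.1⟩ (c : ℂ)).2
    rw [sobolevNorm]
    refine lt_of_le_of_lt (le_of_eq (eLpNorm_congr_ae ?_)) this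
    filter_upwards [h0] with ξ h
    rw [h]
    ext i
    simp
    ring
  · filter_upwards [h0, hu.2] with ξ h h1
    rw [h]
    simp only [Pi.smul_apply, PiLp.smul_apply, smul_eq_mul, mul_left_comm _ (c : ℂ),
      ← Finset.mul_sum, h1, mul_zero]

/-- The constraint space `H^s_st = {∇_sym (-Δ)^{-1/2} u : u ∈ H^s_df}` (for `s ≥ 0`). In
particular `Hst 0` is `L²_st`. -/
def Hst (s : ℝ) : Submodule ℝ MatrixField where
  carrier := {S | ∃ u : VectorField, MemHdf s u ∧ IsSymGradRiesz u S}
  zero_mem' := by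
    refine ⟨0, MemHdf.zero s, fun i j => ?_⟩
    rw [fourierL2_zero, fourierL2_zero]
    filter_upwards [Lp.coeFn_zero (EuclideanSpace ℂ (Fin 3)) 2 (volume : Measure R3),
      Lp.coeFn_zero (EuclideanSpace ℂ (Fin 3 × Fin 3)) 2 (volume : Measure R3)] with ξ h1 h2
    rw [h1, h2]
    simp
  add_mem' := by
    rintro S S' ⟨u, hu, hS⟩ ⟨u', hu', hS'⟩
    refine ⟨u + u', hu.add hu', fun i j => ?_⟩
    rw [fourierL2_add, fourierL2_add]
    filter_upwards [Lp.coeFn_add (fourierL2 u) (fourierL2 u'),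
      Lp.coeFn_add (fourierL2 S) (fourierL2 S'), hS i j, hS' i j] with ξ h1 h2 h3 h4
    rw [h1, h2]
    simp only [Pi.add_apply, PiLp.add_apply, h3, h4]
    ring
  smul_mem' := by
    rintro c S ⟨u, hu, hS⟩
    refine ⟨c • u, hu.smul c, fun i j => ?_⟩
    rw [fourierL2_smul, fourierL2_smul]
    filter_upwards [Lp.coeFn_smul (c : ℂ) (fourierL2 u),
      Lp.coeFn_smul (c : ℂ) (fourierL2 S), hS i j] with ξ h1 h2 h3
    rw [h1, h2]
    simp only [Pi.smul_apply, PiLp.smul_apply, smul_eq_mul, h3]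
    ring

/-- `P_st`, the orthogonal projection of `L²(ℝ³; ℝ^{3×3})` onto `L²_st`. (`L²_st` is closed in
`L²`, so taking the topological closure, which Lean needs in order to know that the
projection exists, changes nothing.) -/
def Pst : MatrixField →L[ℝ] MatrixField :=
  (Hst 0).topologicalClosure.starProjection

/-! ## The heat semigroup -/

/-- The heat kernel `G(x, t) = (4πt)^{-3/2} exp(-|x|² / (4t))`. -/
def heatKernel (t : ℝ) (x : R3) : ℝ :=
  1 / (4 * Real.pi * t) ^ (3 / 2 : ℝ) * Real.exp (-‖x‖ ^ 2 / (4 * t))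

/-- The convolution `G(·, t) * f`. -/
def heatConv (t : ℝ) (f : MatrixField) (x : R3) : EuclideanSpace ℝ (Fin 3 × Fin 3) :=
  ∫ y : R3, heatKernel t y • f (x - y)

lemma heatKernel_nonneg {t : ℝ} (ht : 0 < t) (x : R3) : 0 ≤ heatKernel t x := by
  unfold heatKernel; positivity

lemma integrable_heatKernel {t : ℝ} (ht : 0 < t) :
    Integrable (heatKernel t) (volume : Measure R3) := by
  have h := (GaussianFourier.integrable_cexp_neg_mul_sq_norm_add (V := R3)
    (b := ((1 / (4 * t) : ℝ) : ℂ)) (by rw [Complex.ofReal_re]; positivity) 0 0).norm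
  refine (h.const_mul (1 / (4 * Real.pi * t) ^ (3 / 2 : ℝ))).congr ?_
  refine Filter.Eventually.of_forall fun x => ?_
  simp only [heatKernel, zero_mul, add_zero, Complex.norm_exp]
  congr 2
  rw [← Complex.ofReal_pow, ← Complex.ofReal_neg, ← Complex.ofReal_mul, Complex.ofReal_re]
  ring

lemma memLp_heatConv {t : ℝ} (ht : 0 < t) (f : MatrixField) :
    MemLp (heatConv t f) 2 (volume : Measure R3) := by
  have hG := integrable_heatKernel ht
  have hf := Lp.memLp f
  have hfm : AEStronglyMeasurable f (volume : Measure R3) := hf.1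
  have hg : Integrable (fun x : R3 => ‖f x‖ ^ 2) volume := hf.integrable_norm_pow two_ne_zero
  have hprod := hG.convolution_integrand (ContinuousLinearMap.lsmul ℝ ℝ) hg
  have hprodm := hG.1.convolution_integrand
    (ContinuousLinearMap.lsmul ℝ ℝ : ℝ →L[ℝ] EuclideanSpace ℝ (Fin 3 × Fin 3) →L[ℝ] _) hfm
  have hmeas : AEStronglyMeasurable (heatConv t f) (volume : Measure R3) :=
    hprodm.integral_prod_right'
  rw [memLp_two_iff_integrable_sq_norm hmeas]
  set I : ℝ := ∫ y : R3, heatKernel t y with hI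
  have hI0 : 0 ≤ I := integral_nonneg fun y => heatKernel_nonneg ht y
  refine (hprod.integral_prod_left.const_mul (I + 1)).mono' (hmeas.norm.pow 2) ?_
  filter_upwards [hprod.prod_right_ae, hprodm.prodMk_left] with x hx1 hx2
  simp only [ContinuousLinearMap.lsmul_apply, smul_eq_mul] at hx1 hx2 ⊢
  have hN : Integrable (fun y : R3 => heatKernel t y * ‖f (x - y)‖) volume := by
    refine (hG.add hx1).mono' ?_ ?_
    · refine hx2.norm.congr (Filter.Eventually.of_forall fun y => ?_)
      simp [norm_smul, abs_of_nonneg (heatKernel_nonneg ht y)]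
    · refine Filter.Eventually.of_forall fun y => ?_
      have h0 := heatKernel_nonneg ht y
      simp only [Pi.add_apply, norm_mul, norm_norm, Real.norm_of_nonneg h0]
      nlinarith [sq_nonneg (‖f (x - y)‖ - 1), norm_nonneg (f (x - y))]
  set N : ℝ := ∫ y : R3, heatKernel t y * ‖f (x - y)‖ with hNdef
  set M : ℝ := ∫ y : R3, heatKernel t y * ‖f (x - y)‖ ^ 2 with hMdef
  have hle : ‖heatConv t f x‖ ≤ N := by
    refine (norm_integral_le_integral_norm _).trans (le_of_eq ?_)
    refine integral_congr_ae (Filter.Eventually.of_forall fun y => ?_)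
    simp [norm_smul, abs_of_nonneg (heatKernel_nonneg ht y)]
  have hN0 : 0 ≤ N := (norm_nonneg _).trans hle
  have key : ∀ c : ℝ, 0 ≤ M - 2 * c * N + c ^ 2 * I := by
    intro c
    have h1 : 0 ≤ ∫ y : R3, heatKernel t y * (‖f (x - y)‖ - c) ^ 2 :=
      integral_nonneg fun y => mul_nonneg (heatKernel_nonneg ht y) (sq_nonneg _)
    have h2 : ∫ y : R3, heatKernel t y * (‖f (x - y)‖ - c) ^ 2 =
        M - 2 * c * N + c ^ 2 * I := by
      rw [hMdef, hNdef, hI, ← integral_const_mul, ← integral_const_mul, ← integral_sub hx1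
        (hN.const_mul _)]
      refine Eq.trans ?_ (integral_add (hx1.sub (hN.const_mul (2 * c))) (hG.const_mul (c ^ 2)))
      refine integral_congr_ae (Filter.Eventually.of_forall fun y => ?_)
      ring
    rwa [h2] at h1
  have hfin : N ^ 2 ≤ (I + 1) * M := by
    have h := key (N / (I + 1))
    have hpos : 0 < I + 1 := by linarith
    have h3 : (I + 1) * (M - 2 * (N / (I + 1)) * N + (N / (I + 1)) ^ 2 * I) =
        (I + 1) * M - N ^ 2 - N ^ 2 / (I + 1) := by
      field_simp
      ring
    have h4 := mul_nonneg hpos.le h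
    have h5 : 0 ≤ N ^ 2 / (I + 1) := by positivity
    linarith
  rw [Real.norm_of_nonneg (by positivity)]
  exact (pow_le_pow_left₀ (norm_nonneg _) hle 2).trans hfin

/-- The heat semigroup `e^{tΔ} f = G(·, t) * f` on `L²`, with `e^{0Δ} f = f`. -/
def heat (t : ℝ) (f : MatrixField) : MatrixField :=
  if ht : 0 < t then (memLp_heatConv ht f).toLp (heatConv t f) else f

/-! ## The model equation -/

/-- The pointwise matrix square `S²`. -/
def sqField (S : MatrixField) (x : R3) : EuclideanSpace ℝ (Fin 3 × Fin 3) :=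
  ofMat (toMat (S x) * toMat (S x))

open Classical in
/-- The matrix square `S²` as an `L²` field. For `S ∈ H¹ ⊆ L⁴` it always belongs to `L²`. -/
def sqL2 (S : MatrixField) : MatrixField :=
  if h : MemLp (sqField S) 2 (volume : Measure R3) then h.toLp (sqField S) else 0

/-- The time interval `[0, T)`, where `T` may be `+∞`. -/
def timeInterval (T : EReal) : Set ℝ := {t | 0 ≤ t ∧ (t : EReal) < T}

/-- `S ∈ C([0, T); H¹_st)`. -/
def ContinuousInH1st (T : EReal) (S : ℝ → MatrixField) : Prop :=
  (∀ t ∈ timeInterval T, S t ∈ Hst 1) ∧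
    ∀ t ∈ timeInterval T,
      Tendsto (fun r => sobolevNorm 1 (S r - S t)) (𝓝[timeInterval T] t) (𝓝 0)

/-- Mild solutions on `[0, T)`, of class `C([0, T); H¹_st)`, of the strain self-amplification
model equation `∂_t S - ΔS + (2/3) P_st(S²) = 0`, in the sense of Duhamel's formula
(an identity in `L²`, with a Bochner integral). -/
structure IsMildSolution (T : EReal) (S : ℝ → MatrixField) : Prop where
  continuous : ContinuousInH1st T S
  duhamel : ∀ t ∈ timeInterval T, 0 < t →
    S t = heat t (S 0) - (2 / 3 : ℝ) • ∫ τ in (0 : ℝ)..t, heat τ (Pst (sqL2 (S (t - τ))))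

/-- The pointwise determinant of a matrix field. -/
def detField (S : MatrixField) (x : R3) : ℝ := (toMat (S x)).det

/-- The enstrophy `E(t) = ‖S(t)‖²_{L²}`. -/
def enstrophy (S : ℝ → MatrixField) (t : ℝ) : ℝ := ‖S t‖ ^ 2

/-- `g(t) = (-3 ‖S(t)‖²_{Ḣ¹} - 4 ∫ det S(t)) / ‖S(t)‖³_{L²}`. -/
def growthRatio (S : ℝ → MatrixField) (t : ℝ) : ℝ :=
  (-3 * homSobolevNorm 1 (S t) ^ 2 - 4 * ∫ x : R3, detField (S t) x) / ‖S t‖ ^ 3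

end StrainModel

end

/-!
Put `D = ‖S‖²_{Ḣ¹}` and `f = -3 D - 4 ∫ det S`. Strain fields are symmetric and trace free, hence
`∫ det S = (1/3) ∫ tr(S³) = (1/3) ⟨S², S⟩`, and `P_st` drops out when tested against them.

Testing the equation with `S` gives the enstrophy balance `∂ₜE = -2 D - 4 ∫ det S = f + D`
(`hasDerivWithinAt_enstrophy`). Moreover the equation is the gradient flow of `-f / 6` on the strain
fields, since the first variation of `f` is `6 ⟨ΔS - (2/3) S², ·⟩`; so formally `∂ₜf = 6 ‖∂ₜS‖²`.
Hence `f` is nondecreasing; as `f(0) ≥ 0`, both `f` and `∂ₜE` stay nonnegative, and `S` never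
vanishes. With `y = ‖S‖ = E^{1/2}` one has `2 y y' = f + D`, and `|y'| ≤ ‖∂ₜS‖`, so that
`(f / y³)' ≥ 6 y'² / y³ - 3 f y' / y⁴ = 3 y' (2 y y' - f) / y⁴ = 3 y' D / y⁴ ≥ 0`. This is the
monotonicity of `g`, and `∂ₜE ≥ f = g E^{3/2} ≥ g₀ E^{3/2}`.

A mild solution in `C([0, T); H¹)` need not have a time derivative in `L²` up to `t = 0`, so the
rate of `f` is used only as a lower bound for its increments: for `r ↓ t`,
`f(r) - f(t) ≥ (6 - ε) ‖S(r) - S(t)‖² / (r - t) - ε (r - t)` (`eventually_growthNumerator_sub_ge`).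
To prove it, the forcing is frozen at time `t`, the solution is cut off to bounded frequencies,
where it is differentiable in time (`hasDerivAt_truncSol`), the rate `6 ‖∂ₜS‖²` is replaced by its
tangents `6 (2 ⟨v, ∂ₜS⟩ - ‖v‖²)`, whose time integrals pass to the limit in the cutoff
(`gradient_inequality`), and `v` is taken to be the difference quotient of the solution. The
enstrophy balance also passes to this limit (`energy_identity`). The monotonicity statements then
follow from one-sided difference quotients (`monotoneOn_of_right_lower_bound`,
`monotoneOn_div_cube`).

On the way, the heat semigroup is identified with its Fourier multiplier (`fourierL2_heat`), and the
cubic terms are controlled by the Sobolev embedding `H¹ ⊆ L⁴` (`exists_eLpNorm_four_le`), which is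
proved by splitting frequencies at a height proportional to the level of the distribution function.
-/

noncomputable section

namespace StrainModel

variable {ι : Type} [Fintype ι]

/-! ### The Plancherel transform -/

/-- Complex `L²` fields on frequency space. -/
abbrev CField (ι : Type) [Fintype ι] : Type :=
  Lp (EuclideanSpace ℂ ι) 2 (volume : Measure R3)

lemma complexify_apply (v : EuclideanSpace ℝ ι) (i : ι) :
    complexify ι v i = (v i : ℂ) := rfl

lemma norm_complexify (v : EuclideanSpace ℝ ι) :
    ‖complexify ι v‖ = ‖v‖ := by
  simp [EuclideanSpace.norm_eq, complexify_apply]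

lemma norm_complexify_compLp (f : L2Field ι) :
    ‖((complexify ι).compLp f : CField ι)‖ = ‖f‖ := by
  refine le_antisymm (Lp.norm_le_norm_of_ae_le ?_) (Lp.norm_le_norm_of_ae_le ?_)
  all_goals
    filter_upwards [(complexify ι).coeFn_compLp f] with x hx
    rw [hx, norm_complexify]

lemma norm_fourierL2 (f : L2Field ι) : ‖fourierL2 f‖ = ‖f‖ := by
  rw [fourierL2, Lp.norm_fourier_eq, norm_complexify_compLp]

lemma complex_smul_eq_real_smul (c : ℝ) (f : CField ι) :
    (c : ℂ) • f = c • f := by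
  ext1
  filter_upwards [Lp.coeFn_smul c f, Lp.coeFn_smul (c : ℂ) f] with x h2 h3
  rw [h2, h3]
  ext i
  simp

/-- The Fourier transform of real fields, as a real linear isometry. -/
def fourierIsometry (ι : Type) [Fintype ι] : L2Field ι →ₗᵢ[ℝ] CField ι where
  toFun := fourierL2
  map_add' := fourierL2_add
  map_smul' c f := by rw [fourierL2_smul, complex_smul_eq_real_smul]; rfl
  norm_map' := norm_fourierL2

lemma fourierL2_sub (f g : L2Field ι) :
    fourierL2 (f - g) = fourierL2 f - fourierL2 g := (fourierIsometry ι).map_sub f g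

lemma re_inner_eq_norm_add (x y : CField ι) :
    (inner ℂ x y).re = (‖x + y‖ ^ 2 - ‖x‖ ^ 2 - ‖y‖ ^ 2) / 2 := by
  have := norm_add_sq (𝕜 := ℂ) x y
  simp only [RCLike.re_eq_complex_re] at this
  linarith

lemma re_inner_fourierL2 (f g : L2Field ι) :
    (inner ℂ (fourierL2 f) (fourierL2 g)).re = inner ℝ f g := by
  rw [re_inner_eq_norm_add, ← fourierL2_add, norm_fourierL2, norm_fourierL2, norm_fourierL2,
    norm_add_sq_real]
  ring

/-- The `L²` Fourier transform acts on the arguments only: it commutes with linear maps applied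
to the values. -/
lemma fourier_compLp {E F : Type*} [NormedAddCommGroup E] [InnerProductSpace ℂ E] [CompleteSpace E]
    [NormedAddCommGroup F] [InnerProductSpace ℂ F] [CompleteSpace F] (L : E →L[ℂ] F)
    (f : Lp E 2 (volume : Measure R3)) :
    (𝓕 (L.compLp f : Lp F 2 (volume : Measure R3)) : Lp F 2 (volume : Measure R3)) =
      L.compLp (𝓕 f : Lp E 2 (volume : Measure R3)) := by
  refine DenseRange.induction_on
    (p := fun f : Lp E 2 (volume : Measure R3) =>
      (𝓕 (L.compLp f : Lp F 2 (volume : Measure R3)) : Lp F 2 (volume : Measure R3)) =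
      L.compLp (𝓕 f : Lp E 2 (volume : Measure R3)))
    (SchwartzMap.denseRange_toLpCLM (E := R3) (F := E) (p := 2) (μ := volume)
      ENNReal.ofNat_ne_top) f ?_ ?_
  · apply isClosed_eq
    · exact (Lp.fourierTransformₗᵢ R3 F).continuous.comp (L.compLpL 2 volume).continuous
    · exact (L.compLpL 2 volume).continuous.comp (Lp.fourierTransformₗᵢ R3 E).continuous
  · intro g
    have h : ∀ g : SchwartzMap R3 E, (L.compLp (g.toLp 2 (volume : Measure R3)) :
        Lp F 2 (volume : Measure R3)) = (g.postcompCLM L).toLp 2 := by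
      intro g
      ext1
      filter_upwards [L.coeFn_compLp (g.toLp 2 (volume : Measure R3)),
        SchwartzMap.coeFn_toLp g 2 (volume : Measure R3),
        SchwartzMap.coeFn_toLp (g.postcompCLM L) 2 (volume : Measure R3)] with x h1 h2 h3
      rw [h1, h2, h3, SchwartzMap.postcompCLM_apply]
    rw [SchwartzMap.toLpCLM_apply, h, SchwartzMap.toLp_fourier_eq, SchwartzMap.toLp_fourier_eq, h]
    congr 1
    ext x
    rw [SchwartzMap.postcompCLM_apply, SchwartzMap.fourier_coe, SchwartzMap.fourier_coe,
      Real.fourier_eq, Real.fourier_eq, ← L.integral_comp_comm]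
    · refine integral_congr_ae (Eventually.of_forall fun y => ?_)
      simp [SchwartzMap.postcompCLM_apply, Circle.smul_def]
    · exact (Real.fourierIntegral_convergent_iff x).2 g.integrable

/-- On `L¹ ∩ L²` the inverse Plancherel transform is given by the Fourier integral: both define
the same tempered distribution. -/
lemma fourierInv_ae_eq_of_integrable {F : Type*} [NormedAddCommGroup F] [InnerProductSpace ℂ F]
    [CompleteSpace F] (g : Lp F 2 (volume : Measure R3)) (hg : Integrable g (volume : Measure R3)) :
    (𝓕⁻ g : Lp F 2 (volume : Measure R3)) =ᵐ[volume] 𝓕⁻ (g : R3 → F) := by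
  have hcont : Continuous (𝓕⁻ (g : R3 → F)) := by
    have h := Real.Lp.fourierTransformInv_toLp (memLp_one_iff_integrable.2 hg)
    rw [← h]
    exact (Real.Lp.fourierTransformInv _).continuous
  refine ae_eq_of_integral_contDiff_smul_eq
    ((Lp.memLp (𝓕⁻ g : Lp F 2 (volume : Measure R3))).locallyIntegrable (by norm_num))
    hcont.locallyIntegrable fun φ hφ hφc => ?_
  have hφ' : HasCompactSupport (Complex.ofRealCLM ∘ φ) := hφc.comp_left rfl
  have hφ'' : ContDiff ℝ ((⊤ : ℕ∞) : WithTop ℕ∞) (Complex.ofRealCLM ∘ φ) := by fun_prop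
  have key := congrArg (fun T => T (hφ'.toSchwartzMap hφ''))
    (Lp.fourierInv_toTemperedDistribution_eq g)
  simp only [TemperedDistribution.fourierInv_apply, Lp.toTemperedDistribution_apply] at key
  have hflip : (-innerₗ R3).flip = -innerₗ R3 := by
    ext x y
    simp [real_inner_comm]
  have hswap := VectorFourier.integral_fourierIntegral_smul_eq_flip (μ := (volume : Measure R3))
    (ν := (volume : Measure R3)) (L := -innerₗ R3) (f := hφ'.toSchwartzMap hφ'') (g := (g : R3 → F))
    Real.continuous_fourierChar (by
      change Continuous fun p : R3 × R3 => -(inner ℝ p.1 p.2); fun_prop)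
    (SchwartzMap.integrable _) hg
  rw [hflip] at hswap
  have h1 : ∫ x, φ x • (𝓕⁻ g : Lp F 2 (volume : Measure R3)) x =
      ∫ x, (hφ'.toSchwartzMap hφ'') x • (𝓕⁻ g : Lp F 2 (volume : Measure R3)) x := by simp
  have h2 : ∫ x, φ x • (𝓕⁻ (g : R3 → F)) x =
      ∫ x, (hφ'.toSchwartzMap hφ'') x • (𝓕⁻ (g : R3 → F)) x := by simp
  rw [h1, h2, ← key]
  refine Eq.trans (integral_congr_ae (Eventually.of_forall fun x => ?_)) hswap
  simp only [SchwartzMap.fourierInv_coe]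
  rfl

/-! ### Fourier multipliers -/

/-- Bounded measurable real symbols. -/
def IsSymbol (m : R3 → ℝ) : Prop := Measurable m ∧ ∃ C, ∀ ξ, |m ξ| ≤ C

lemma IsSymbol.of_le {m : R3 → ℝ} (hm : Measurable m) {C : ℝ} (hC : ∀ ξ, |m ξ| ≤ C) :
    IsSymbol m := ⟨hm, C, hC⟩

lemma IsSymbol.mul {m n : R3 → ℝ} (hm : IsSymbol m) (hn : IsSymbol n) :
    IsSymbol fun ξ => m ξ * n ξ := by
  obtain ⟨hm1, C, hC⟩ := hm
  obtain ⟨hn1, D, hD⟩ := hn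
  refine ⟨hm1.mul hn1, C * D, fun ξ => ?_⟩
  rw [abs_mul]
  exact mul_le_mul (hC ξ) (hD ξ) (abs_nonneg _) ((abs_nonneg _).trans (hC ξ))

lemma IsSymbol.memLp_smul {m : R3 → ℝ} (hm : IsSymbol m) (f : CField ι) :
    MemLp (fun ξ => m ξ • f ξ) 2 (volume : Measure R3) := by
  obtain ⟨hm1, C, hC⟩ := hm
  refine MemLp.of_le_mul (c := C) (Lp.memLp f)
    (hm1.aestronglyMeasurable.smul (Lp.aestronglyMeasurable f))
    (Eventually.of_forall fun ξ => ?_)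
  rw [norm_smul, Real.norm_eq_abs]
  exact mul_le_mul_of_nonneg_right (hC ξ) (norm_nonneg _)

open Classical in
/-- Multiplication by a symbol on the frequency side; zero if the symbol is not bounded and
measurable. -/
def mulOp (m : R3 → ℝ) : CField ι →L[ℝ] CField ι :=
  if hm : IsSymbol m then
    LinearMap.mkContinuousOfExistsBound
      { toFun := fun f => (hm.memLp_smul f).toLp _
        map_add' := fun f g => by
          rw [← MemLp.toLp_add]
          refine MemLp.toLp_congr _ _ ?_
          filter_upwards [Lp.coeFn_add f g] with ξ h
          rw [h, Pi.add_apply, smul_add]; rfl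
        map_smul' := fun c f => by
          rw [RingHom.id_apply, ← MemLp.toLp_const_smul]
          refine MemLp.toLp_congr _ _ ?_
          filter_upwards [Lp.coeFn_smul c f] with ξ h
          rw [h, Pi.smul_apply, smul_comm]; rfl }
      (by
        obtain ⟨C, hC⟩ := hm.2
        refine ⟨C, fun f => Lp.norm_le_mul_norm_of_ae_le_mul ?_⟩
        filter_upwards [MemLp.coeFn_toLp (hm.memLp_smul f)] with ξ h
        simp only [LinearMap.coe_mk, AddHom.coe_mk, h]
        rw [norm_smul, Real.norm_eq_abs]
        exact mul_le_mul_of_nonneg_right (hC ξ) (norm_nonneg _))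
  else 0

lemma coeFn_mulOp {m : R3 → ℝ} (hm : IsSymbol m) (f : CField ι) :
    mulOp m f =ᵐ[volume] fun ξ => m ξ • f ξ := by
  rw [mulOp, dif_pos hm]
  exact MemLp.coeFn_toLp (hm.memLp_smul f)

lemma norm_mulOp_apply_le {m : R3 → ℝ} (hm : IsSymbol m) {C : ℝ} (hC : ∀ ξ, |m ξ| ≤ C)
    (f : CField ι) : ‖mulOp m f‖ ≤ C * ‖f‖ := by
  refine Lp.norm_le_mul_norm_of_ae_le_mul ?_
  filter_upwards [coeFn_mulOp hm f] with ξ h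
  rw [h, norm_smul, Real.norm_eq_abs]
  exact mul_le_mul_of_nonneg_right (hC ξ) (norm_nonneg _)

lemma mulOp_eq_of_ae {m : R3 → ℝ} (hm : IsSymbol m) {f g : CField ι}
    (h : g =ᵐ[volume] fun ξ => m ξ • f ξ) : mulOp m f = g := by
  ext1
  exact (coeFn_mulOp hm f).trans h.symm

lemma mulOp_mulOp {m n : R3 → ℝ} (hm : IsSymbol m) (hn : IsSymbol n) (f : CField ι) :
    mulOp m (mulOp n f) = mulOp (fun ξ => m ξ * n ξ) f := by
  refine mulOp_eq_of_ae hm ?_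
  filter_upwards [coeFn_mulOp hn f, coeFn_mulOp (hm.mul hn) f] with ξ h1 h2
  rw [h1, h2, smul_smul]

/-- Real symbols act symmetrically. -/
lemma inner_mulOp_left {m : R3 → ℝ} (hm : IsSymbol m) (f g : CField ι) :
    inner ℂ (mulOp m f) g = inner ℂ f (mulOp m g) := by
  rw [L2.inner_def, L2.inner_def]
  refine integral_congr_ae ?_
  filter_upwards [coeFn_mulOp hm f, coeFn_mulOp hm g] with ξ h1 h2
  rw [h1, h2, RCLike.real_smul_eq_coe_smul (K := ℂ), RCLike.real_smul_eq_coe_smul (K := ℂ),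
    inner_smul_left, inner_smul_right]
  simp

/-! ### The heat semigroup on the frequency side -/

/-- The symbol `exp(-t (2π|ξ|)²)` of `e^{tΔ}`. -/
def heatSymbol (t : ℝ) (ξ : R3) : ℝ := Real.exp (-(t * (2 * Real.pi * ‖ξ‖) ^ 2))

lemma continuous_heatSymbol (t : ℝ) : Continuous (heatSymbol t) := by
  unfold heatSymbol; fun_prop

lemma heatSymbol_pos (t : ℝ) (ξ : R3) : 0 < heatSymbol t ξ := Real.exp_pos _

lemma heatSymbol_le_one {t : ℝ} (ht : 0 ≤ t) (ξ : R3) : heatSymbol t ξ ≤ 1 := by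
  refine Real.exp_le_one_iff.2 (neg_nonpos.2 (by positivity))

lemma isSymbol_heatSymbol {t : ℝ} (ht : 0 ≤ t) : IsSymbol (heatSymbol t) :=
  .of_le (continuous_heatSymbol t).measurable (C := 1) fun ξ => by
    rw [abs_of_pos (heatSymbol_pos t ξ)]; exact heatSymbol_le_one ht ξ

lemma fourier_heatKernel {t : ℝ} (ht : 0 < t) (ξ : R3) :
    𝓕 (fun x => (heatKernel t x : ℂ)) ξ = heatSymbol t ξ := by
  have h := fourier_gaussian_innerProductSpace (V := R3) (b := ((1 / (4 * t) : ℝ) : ℂ))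
    (by rw [Complex.ofReal_re]; positivity) ξ
  have h1 : (fun x : R3 => (heatKernel t x : ℂ)) =
      ((1 / (4 * Real.pi * t) ^ (3 / 2 : ℝ) : ℝ) : ℂ) •
        fun x : R3 => Complex.exp (-((1 / (4 * t) : ℝ) : ℂ) * ‖x‖ ^ 2) := by
    funext x
    simp only [heatKernel, Pi.smul_apply, smul_eq_mul]
    push_cast
    congr 2
    ring
  have h2 : 𝓕 (((1 / (4 * Real.pi * t) ^ (3 / 2 : ℝ) : ℝ) : ℂ) •
        fun x : R3 => Complex.exp (-((1 / (4 * t) : ℝ) : ℂ) * ‖x‖ ^ 2)) =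
      ((1 / (4 * Real.pi * t) ^ (3 / 2 : ℝ) : ℝ) : ℂ) •
        𝓕 fun x : R3 => Complex.exp (-((1 / (4 * t) : ℝ) : ℂ) * ‖x‖ ^ 2) :=
    VectorFourier.fourierIntegral_const_smul _ _ _ _ _
  rw [h1, h2, Pi.smul_apply, h, smul_eq_mul]
  have hc : ((Real.pi : ℂ) / ((1 / (4 * t) : ℝ) : ℂ)) ^ (Module.finrank ℝ R3 / 2 : ℂ) =
      (((4 * Real.pi * t) ^ (3 / 2 : ℝ) : ℝ) : ℂ) := by
    rw [Complex.ofReal_cpow (by positivity)]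
    congr 1
    · push_cast; field_simp
    · simp
  rw [hc, ← mul_assoc, ← Complex.ofReal_mul, one_div_mul_cancel (by positivity)]
  simp only [heatSymbol]
  push_cast
  rw [one_mul]
  congr 1
  field_simp
  ring

/-- Convolution of a complex field with the heat kernel. -/
def cHeatConv (t : ℝ) (f : R3 → EuclideanSpace ℂ ι) (x : R3) : EuclideanSpace ℂ ι :=
  ∫ y : R3, heatKernel t y • f (x - y)

lemma cHeatConv_congr {t : ℝ} {f g : R3 → EuclideanSpace ℂ ι} (h : f =ᵐ[volume] g) :
    cHeatConv t f = cHeatConv t g := by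
  funext x
  refine integral_congr_ae ?_
  filter_upwards [(quasiMeasurePreserving_sub_left_of_right_invariant volume x).ae_eq_comp h]
    with y hy
  simp only [Function.comp_apply] at hy
  rw [hy]

lemma memLp_heatKernel {t : ℝ} (ht : 0 < t) : MemLp (heatKernel t) 2 (volume : Measure R3) := by
  rw [memLp_two_iff_integrable_sq (integrable_heatKernel ht).1]
  refine ((integrable_heatKernel ht).const_mul (1 / (4 * Real.pi * t) ^ (3 / 2 : ℝ))).mono'
    ((integrable_heatKernel ht).1.pow 2) (Eventually.of_forall fun x => ?_)
  have h0 := heatKernel_nonneg ht x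
  rw [Real.norm_of_nonneg (by positivity), pow_two]
  refine mul_le_mul_of_nonneg_right ?_ h0
  unfold heatKernel
  refine mul_le_of_le_one_right (by positivity) (Real.exp_le_one_iff.2 ?_)
  rw [neg_div]
  exact neg_nonpos.2 (by positivity)

lemma memLp_comp_sub_left (f : CField ι) (x : R3) :
    MemLp (fun y => f (x - y)) 2 (volume : Measure R3) :=
  (Lp.memLp f).comp_measurePreserving (Measure.measurePreserving_sub_left (volume : Measure R3) x)

lemma integrable_heatKernel_smul {t : ℝ} (ht : 0 < t) (f : CField ι) (x : R3) :
    Integrable (fun y => heatKernel t y • f (x - y)) (volume : Measure R3) :=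
  memLp_one_iff_integrable.1 ((memLp_comp_sub_left f x).smul (memLp_heatKernel ht))

/-- By the Cauchy–Schwarz inequality, convolution with the heat kernel is continuous from `L²` to
bounded functions. -/
lemma norm_cHeatConv_sub_le {t : ℝ} (ht : 0 < t) (f g : CField ι) (x : R3) :
    ‖cHeatConv t f x - cHeatConv t g x‖ ≤
      (eLpNorm (heatKernel t) 2 (volume : Measure R3)).toReal * ‖f - g‖ := by
  have h1 : cHeatConv t f x - cHeatConv t g x =
      ∫ y : R3, heatKernel t y • ((f - g : CField ι) (x - y)) := by
    rw [cHeatConv, cHeatConv, ← integral_sub (integrable_heatKernel_smul ht f x)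
      (integrable_heatKernel_smul ht g x)]
    refine integral_congr_ae ?_
    filter_upwards [(quasiMeasurePreserving_sub_left_of_right_invariant volume x).ae_eq_comp
      (Lp.coeFn_sub f g)] with y hy
    simp only [Function.comp_apply, Pi.sub_apply] at hy
    rw [hy, smul_sub]
  rw [h1]
  refine (norm_integral_le_lintegral_norm _).trans ?_
  rw [Lp.norm_def, ← ENNReal.toReal_mul]
  refine ENNReal.toReal_mono (ENNReal.mul_ne_top (memLp_heatKernel ht).2.ne
    (Lp.memLp (f - g)).2.ne) ?_
  have h2 := eLpNorm_smul_le_mul_eLpNorm (p := 2) (q := 2) (r := 1)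
    (memLp_comp_sub_left (f - g) x).1 (memLp_heatKernel ht).1
  have h3 : eLpNorm (fun y => (f - g : CField ι) (x - y)) 2 (volume : Measure R3) =
      eLpNorm (f - g : CField ι) 2 volume :=
    eLpNorm_comp_measurePreserving (Lp.aestronglyMeasurable _)
      (Measure.measurePreserving_sub_left (volume : Measure R3) x)
  rw [h3, eLpNorm_one_eq_lintegral_enorm] at h2
  refine le_trans (le_of_eq ?_) h2
  simp [ofReal_norm]

/-- For Schwartz functions, convolution with the heat kernel is the multiplier. -/
lemma cHeatConv_schwartz {t : ℝ} (ht : 0 < t) (g : SchwartzMap R3 (EuclideanSpace ℂ ι)) :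
    cHeatConv t g = 𝓕⁻ (fun ξ => heatSymbol t ξ • 𝓕 (g : R3 → EuclideanSpace ℂ ι) ξ) := by
  have hG : Integrable (fun x => (heatKernel t x : ℂ)) (volume : Measure R3) :=
    (integrable_heatKernel ht).ofReal
  have h1 : cHeatConv t g = convolution (fun x => (heatKernel t x : ℂ)) g
      (ContinuousLinearMap.lsmul ℂ ℂ) volume := by
    funext x
    refine integral_congr_ae (Eventually.of_forall fun y => ?_)
    simp only [ContinuousLinearMap.lsmul_apply]
    exact RCLike.real_smul_eq_coe_smul (K := ℂ) _ _
  have h2 : 𝓕 (cHeatConv t g) = fun ξ => heatSymbol t ξ • 𝓕 (g : R3 → EuclideanSpace ℂ ι) ξ := by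
    funext ξ
    rw [h1, Real.fourier_smul_convolution_eq hG g.integrable, fourier_heatKernel ht]
    exact (RCLike.real_smul_eq_coe_smul (K := ℂ) _ _).symm
  have hcont : Continuous (cHeatConv t g) := by
    rw [h1]
    refine BddAbove.continuous_convolution_right_of_integrable _ ?_ hG g.continuous
    refine ⟨SchwartzMap.seminorm ℂ 0 0 g, ?_⟩
    rintro _ ⟨x, rfl⟩
    exact SchwartzMap.norm_le_seminorm ℂ g x
  have hint : Integrable (cHeatConv t g) := by
    rw [h1]
    exact hG.integrable_convolution _ g.integrable
  rw [← h2]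
  refine (hcont.fourierInv_fourier_eq hint ?_).symm
  rw [h2]
  have h3 : Integrable (𝓕 (g : R3 → EuclideanSpace ℂ ι)) := by
    rw [← SchwartzMap.fourier_coe]
    exact SchwartzMap.integrable _
  refine h3.mono ((continuous_heatSymbol t).aestronglyMeasurable.smul h3.1)
    (Eventually.of_forall fun ξ => ?_)
  rw [norm_smul, Real.norm_of_nonneg (heatSymbol_pos t ξ).le]
  exact mul_le_of_le_one_left (norm_nonneg _) (heatSymbol_le_one ht.le ξ)

lemma cHeatConv_schwartz_ae_eq {t : ℝ} (ht : 0 < t) (g : SchwartzMap R3 (EuclideanSpace ℂ ι)) :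
    cHeatConv t (g.toLp 2 : CField ι) =ᵐ[volume]
      (𝓕⁻ (mulOp (heatSymbol t) (𝓕 (g.toLp 2) : CField ι)) : CField ι) := by
  have hae : (mulOp (heatSymbol t) (𝓕 (g.toLp 2) : CField ι) : CField ι) =ᵐ[volume]
      fun ξ => heatSymbol t ξ • 𝓕 (g : R3 → EuclideanSpace ℂ ι) ξ := by
    rw [SchwartzMap.toLp_fourier_eq]
    filter_upwards [coeFn_mulOp (isSymbol_heatSymbol ht.le) ((𝓕 g).toLp 2 : CField ι),
      SchwartzMap.coeFn_toLp (𝓕 g) 2 (volume : Measure R3)] with ξ h1 h2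
    rw [h1, h2, SchwartzMap.fourier_coe]
  have hint : Integrable (mulOp (heatSymbol t) (𝓕 (g.toLp 2) : CField ι) : CField ι)
      (volume : Measure R3) := by
    have h3 : Integrable (𝓕 (g : R3 → EuclideanSpace ℂ ι)) := by
      rw [← SchwartzMap.fourier_coe]
      exact SchwartzMap.integrable _
    refine h3.mono (Lp.aestronglyMeasurable _) ?_
    filter_upwards [hae] with ξ h
    rw [h, norm_smul, Real.norm_of_nonneg (heatSymbol_pos t ξ).le]
    exact mul_le_of_le_one_left (norm_nonneg _) (heatSymbol_le_one ht.le ξ)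
  filter_upwards [fourierInv_ae_eq_of_integrable _ hint] with x hx
  rw [hx, cHeatConv_congr (SchwartzMap.coeFn_toLp g 2 (volume : Measure R3)),
    cHeatConv_schwartz ht, Real.fourierInv_congr_ae hae]

/-- Convolution with the heat kernel is the Fourier multiplier `exp(-t (2π|ξ|)²)`. Schwartz
functions are dense in `L²`; along an approximating sequence the left side converges pointwise and
a subsequence of the right side converges almost everywhere. -/
lemma cHeatConv_ae_eq {t : ℝ} (ht : 0 < t) (f : CField ι) :
    cHeatConv t f =ᵐ[volume] (𝓕⁻ (mulOp (heatSymbol t) (𝓕 f : CField ι)) : CField ι) := by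
  have hd : f ∈ closure
      (Set.range (SchwartzMap.toLpCLM ℝ (E := R3) (EuclideanSpace ℂ ι) 2 volume)) :=
    SchwartzMap.denseRange_toLpCLM (E := R3) (p := 2) (μ := volume) ENNReal.ofNat_ne_top f
  obtain ⟨u, hu, hlim⟩ := mem_closure_iff_seq_limit.1 hd
  have hT : Tendsto (fun n => (𝓕⁻ (mulOp (heatSymbol t) (𝓕 (u n) : CField ι)) : CField ι)) atTop
      (𝓝 (𝓕⁻ (mulOp (heatSymbol t) (𝓕 f : CField ι)) : CField ι)) := by
    have hc : Continuous fun f : CField ι =>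
        (𝓕⁻ (mulOp (heatSymbol t) (𝓕 f : CField ι)) : CField ι) :=
      (Lp.fourierTransformₗᵢ R3 (EuclideanSpace ℂ ι)).symm.continuous.comp
        ((mulOp (heatSymbol t)).continuous.comp
          (Lp.fourierTransformₗᵢ R3 (EuclideanSpace ℂ ι)).continuous)
    exact (hc.tendsto f).comp hlim
  obtain ⟨ns, hns, hae⟩ := (tendstoInMeasure_of_tendsto_Lp hT).exists_seq_tendsto_ae
  have hall : ∀ᵐ x, ∀ n, cHeatConv t (u n) x =
      (𝓕⁻ (mulOp (heatSymbol t) (𝓕 (u n) : CField ι)) : CField ι) x := by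
    rw [ae_all_iff]
    intro n
    obtain ⟨g, hg⟩ := hu n
    rw [← hg]
    exact cHeatConv_schwartz_ae_eq ht g
  filter_upwards [hae, hall] with x hx1 hx2
  refine tendsto_nhds_unique ?_ hx1
  simp only [← hx2]
  rw [tendsto_iff_norm_sub_tendsto_zero]
  have h0 : Tendsto (fun n => (eLpNorm (heatKernel t) 2 (volume : Measure R3)).toReal *
      ‖u (ns n) - f‖) atTop (𝓝 0) := by
    have := (tendsto_iff_norm_sub_tendsto_zero.1 (hlim.comp hns.tendsto_atTop)).const_mul
      (eLpNorm (heatKernel t) 2 (volume : Measure R3)).toReal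
    simpa using this
  exact squeeze_zero (fun n => norm_nonneg _) (fun n => norm_cHeatConv_sub_le ht _ _ x) h0

/-- On the frequency side the heat semigroup multiplies by `exp(-t (2π|ξ|)²)`. -/
lemma fourierL2_heat {t : ℝ} (ht : 0 ≤ t) (f : MatrixField) :
    fourierL2 (heat t f) = mulOp (heatSymbol t) (fourierL2 f) := by
  rcases ht.eq_or_lt with rfl | ht
  · refine (mulOp_eq_of_ae (isSymbol_heatSymbol le_rfl) ?_).symm
    simp [heat, heatSymbol]
  have h1 : ((complexify _).compLp (heat t f) : CField (Fin 3 × Fin 3)) =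
      𝓕⁻ (mulOp (heatSymbol t) (fourierL2 f)) := by
    ext1
    have hf := (complexify (Fin 3 × Fin 3)).coeFn_compLp f
    filter_upwards [(complexify (Fin 3 × Fin 3)).coeFn_compLp (heat t f),
      cHeatConv_ae_eq ht ((complexify _).compLp f : CField (Fin 3 × Fin 3)),
      MemLp.coeFn_toLp (memLp_heatConv ht f)] with x h1 h2 h3
    rw [h1, heat, dif_pos ht, h3]
    refine Eq.trans ?_ h2
    rw [cHeatConv_congr hf, heatConv, cHeatConv,
      ← ContinuousLinearMap.integral_comp_comm' (complexify (Fin 3 × Fin 3)) (K := 1)]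
    · simp
    · exact (AddMonoidHomClass.isometry_of_norm _ norm_complexify).antilipschitz
  rw [fourierL2, h1]
  exact (Lp.fourierTransformₗᵢ R3 _).apply_symm_apply _

/-! ### The Sobolev embedding `H¹ ⊆ L⁴` -/

/-- The weight `(1 + (2π|ξ|)²)^{1/2}` of the `H¹` norm. -/
def sobWeight (ξ : R3) : ℝ := √(1 + (2 * Real.pi * ‖ξ‖) ^ 2)

lemma sobWeight_eq_rpow (ξ : R3) :
    ((1 + (2 * Real.pi * ‖ξ‖) ^ (2 * 1 : ℝ)) ^ (1 / 2 : ℝ) : ℝ) = sobWeight ξ := by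
  rw [sobWeight, Real.sqrt_eq_rpow, mul_one, ← Real.rpow_natCast]
  norm_num

lemma sobWeight_sq (ξ : R3) : sobWeight ξ ^ 2 = 1 + (2 * Real.pi * ‖ξ‖) ^ 2 :=
  Real.sq_sqrt (by positivity)

lemma one_le_sobWeight (ξ : R3) : 1 ≤ sobWeight ξ :=
  Real.one_le_sqrt.2 (by nlinarith [sq_nonneg (2 * Real.pi * ‖ξ‖)])

lemma sobWeight_pos (ξ : R3) : 0 < sobWeight ξ := one_pos.trans_le (one_le_sobWeight ξ)

lemma continuous_sobWeight : Continuous sobWeight := by unfold sobWeight; fun_prop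

lemma memLp_sobWeight_inv_sq : MemLp (fun ξ => (sobWeight ξ ^ 2)⁻¹) 2 (volume : Measure R3) := by
  have hc : Continuous fun ξ => (sobWeight ξ ^ 2)⁻¹ :=
    (continuous_sobWeight.pow 2).inv₀ fun ξ => (pow_pos (sobWeight_pos ξ) 2).ne'
  rw [memLp_two_iff_integrable_sq hc.aestronglyMeasurable]
  have h := integrable_rpow_neg_one_add_norm_sq (E := R3) (μ := volume) (r := 4) (by simp; norm_num)
  refine h.mono' (hc.pow 2).aestronglyMeasurable (Eventually.of_forall fun ξ => ?_)
  have h2 : ((1 : ℝ) + ‖ξ‖ ^ 2) ^ (-4 / 2 : ℝ) = ((1 + ‖ξ‖ ^ 2)⁻¹) ^ 2 := by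
    rw [show (-4 / 2 : ℝ) = -((2 : ℕ) : ℝ) by norm_num, Real.rpow_neg (by positivity),
      Real.rpow_natCast, inv_pow]
  rw [h2, Real.norm_of_nonneg (by positivity), sobWeight_sq]
  have hpi : 1 ≤ 2 * Real.pi := by linarith [Real.two_le_pi]
  have : ‖ξ‖ ≤ 2 * Real.pi * ‖ξ‖ := le_mul_of_one_le_left (norm_nonneg _) hpi
  gcongr

lemma eLpNorm_two_sq {α E : Type*} [MeasurableSpace α] [NormedAddCommGroup E] {μ : Measure α}
    (f : α → E) : eLpNorm f 2 μ ^ 2 = ∫⁻ x, ‖f x‖ₑ ^ 2 ∂μ := by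
  have := eLpNorm_nnreal_pow_eq_lintegral (f := f) (μ := μ) (p := 2) two_ne_zero
  simpa only [NNReal.coe_ofNat, ENNReal.rpow_ofNat, ENNReal.coe_ofNat] using this

lemma eLpNorm_four_pow {α E : Type*} [MeasurableSpace α] [NormedAddCommGroup E] {μ : Measure α}
    (f : α → E) : eLpNorm f 4 μ ^ 4 = ∫⁻ x, ‖f x‖ₑ ^ 4 ∂μ := by
  have := eLpNorm_nnreal_pow_eq_lintegral (f := f) (μ := μ) (p := 4) four_ne_zero
  simpa only [NNReal.coe_ofNat, ENNReal.rpow_ofNat, ENNReal.coe_ofNat] using this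

/-- The symbol of the projection onto the frequencies with `(1 + (2π|ξ|)²)^{1/2} ≤ A`. -/
def lowPass (A : ℝ) (ξ : R3) : ℝ := Set.indicator {ξ | sobWeight ξ ≤ A} 1 ξ

lemma isSymbol_lowPass (A : ℝ) : IsSymbol (lowPass A) := by
  refine .of_le (C := 1) ?_ fun ξ => ?_
  · exact measurable_one.indicator
      (measurableSet_le continuous_sobWeight.measurable measurable_const)
  · unfold lowPass
    by_cases h : sobWeight ξ ≤ A <;> simp [h]

/-- Low frequencies are bounded: by the Cauchy–Schwarz inequality `ĥ` is integrable on
`{w ≤ A}`, where `w⁻¹ ≤ A w⁻²`, and `w⁻²` is square integrable. -/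
lemma enorm_fourierInv_lowPass_le {A : ℝ} (hA0 : 0 ≤ A) (h : CField ι)
    (hN : eLpNorm (fun ξ => sobWeight ξ • h ξ) 2 volume ≠ ⊤) :
    ∀ᵐ x, ‖(𝓕⁻ (mulOp (lowPass A) h) : CField ι) x‖ₑ ≤ ENNReal.ofReal A *
      (eLpNorm (fun ξ => (sobWeight ξ ^ 2)⁻¹) 2 (volume : Measure R3) *
        eLpNorm (fun ξ => sobWeight ξ • h ξ) 2 volume) := by
  have hm : AEStronglyMeasurable (fun ξ => sobWeight ξ • h ξ) volume :=
    continuous_sobWeight.aestronglyMeasurable.smul (Lp.aestronglyMeasurable h)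
  have h1 : eLpNorm (mulOp (lowPass A) h) 1 volume ≤ ENNReal.ofReal A *
      (eLpNorm (fun ξ => (sobWeight ξ ^ 2)⁻¹) 2 (volume : Measure R3) *
        eLpNorm (fun ξ => sobWeight ξ • h ξ) 2 volume) := by
    have h2 := eLpNorm_smul_le_mul_eLpNorm (p := 2) (q := 2) (r := 1) hm memLp_sobWeight_inv_sq.1
    refine le_trans ?_ (mul_le_mul_right h2 _)
    refine eLpNorm_le_mul_eLpNorm_of_ae_le_mul ?_ 1
    filter_upwards [coeFn_mulOp (isSymbol_lowPass A) h] with ξ hξ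
    rw [hξ, Pi.smul_apply', smul_smul, norm_smul, norm_smul, ← mul_assoc]
    refine mul_le_mul_of_nonneg_right ?_ (norm_nonneg _)
    have hw := sobWeight_pos ξ
    have h3 : (sobWeight ξ ^ 2)⁻¹ * sobWeight ξ = (sobWeight ξ)⁻¹ := by field_simp
    rw [h3, Real.norm_of_nonneg (inv_nonneg.2 hw.le)]
    unfold lowPass
    by_cases hA : sobWeight ξ ≤ A
    · simp only [Set.mem_ofPred_eq, hA, Set.indicator_of_mem, Pi.one_apply, norm_one]
      rw [← div_eq_mul_inv, le_div_iff₀ hw, one_mul]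
      exact hA
    · simp only [Set.mem_ofPred_eq, hA, not_false_eq_true, Set.indicator_of_notMem, norm_zero]
      positivity
  have hint : Integrable (mulOp (lowPass A) h) (volume : Measure R3) := by
    refine memLp_one_iff_integrable.1 ⟨Lp.aestronglyMeasurable _, h1.trans_lt ?_⟩
    exact ENNReal.mul_lt_top ENNReal.ofReal_lt_top
      (ENNReal.mul_lt_top memLp_sobWeight_inv_sq.2 hN.lt_top)
  filter_upwards [fourierInv_ae_eq_of_integrable _ hint] with x hx
  rw [hx, Real.fourierInv_eq]
  refine ((enorm_integral_le_lintegral_enorm _).trans (le_of_eq ?_)).trans h1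
  rw [eLpNorm_one_eq_lintegral_enorm]
  refine lintegral_congr fun ξ => ?_
  rw [← ofReal_norm, ← ofReal_norm, Circle.norm_smul]

/-- The distribution function of `𝓕⁻ h` at height `s` is controlled by the high frequencies: with
the cutoff proportional to `s`, the low frequencies contribute at most `s / 2` pointwise, and the
Chebyshev inequality applies to the rest. -/
lemma measure_le_norm_fourierInv (h : CField ι) {B : ℝ} (hB : 0 < B)
    (hN : eLpNorm (fun ξ => sobWeight ξ • h ξ) 2 volume ≠ ⊤)
    (hNB : eLpNorm (fun ξ => (sobWeight ξ ^ 2)⁻¹) 2 (volume : Measure R3) *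
        eLpNorm (fun ξ => sobWeight ξ • h ξ) 2 volume ≤ ENNReal.ofReal B) {s : ℝ} (hs : 0 < s) :
    volume {x | s ≤ ‖(𝓕⁻ h : CField ι) x‖} * ENNReal.ofReal (s ^ 2) ≤
      4 * ∫⁻ ξ, Set.indicator {ξ | s < 2 * B * sobWeight ξ} (fun ξ => ‖h ξ‖ₑ ^ 2) ξ := by
  set A : ℝ := s / (2 * B) with hA
  set l := mulOp (lowPass A) h
  have hsplit : (𝓕⁻ h : CField ι) = 𝓕⁻ l + 𝓕⁻ (h - l) := by
    rw [← FourierTransform.fourierInv_add, add_sub_cancel]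
  have hle : volume {x | s ≤ ‖(𝓕⁻ h : CField ι) x‖} ≤
      volume {x | ENNReal.ofReal (s / 2) ≤ ‖(𝓕⁻ (h - l) : CField ι) x‖ₑ} := by
    refine measure_mono_ae ?_
    filter_upwards [enorm_fourierInv_lowPass_le (A := A) (by positivity) h hN,
      Lp.coeFn_add (𝓕⁻ l) (𝓕⁻ (h - l))]
      with x h1 h2 (h3 : s ≤ _)
    change ENNReal.ofReal (s / 2) ≤ ‖(𝓕⁻ (h - l) : CField ι) x‖ₑ
    rw [hsplit, h2, Pi.add_apply] at h3
    have h4 : ‖(𝓕⁻ l : CField ι) x‖ ≤ s / 2 := by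
      have h5 : ‖(𝓕⁻ l : CField ι) x‖ₑ ≤ ENNReal.ofReal (A * B) := by
        rw [ENNReal.ofReal_mul (by positivity)]
        exact h1.trans (mul_le_mul_right hNB _)
      rw [← ofReal_norm, ENNReal.ofReal_le_ofReal_iff (by positivity)] at h5
      refine h5.trans (le_of_eq ?_)
      rw [hA]; field_simp
    rw [← ofReal_norm]
    refine ENNReal.ofReal_le_ofReal ?_
    have := norm_add_le ((𝓕⁻ l : CField ι) x) ((𝓕⁻ (h - l) : CField ι) x)
    linarith
  have hcheb := mul_meas_ge_le_pow_eLpNorm' (p := 2) volume two_ne_zero ENNReal.ofNat_ne_top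
    (Lp.aestronglyMeasurable (𝓕⁻ (h - l) : CField ι)) (ENNReal.ofReal (s / 2))
  have hpl : eLpNorm (𝓕⁻ (h - l) : CField ι) 2 volume = eLpNorm (h - l : CField ι) 2 volume := by
    rw [← Lp.enorm_def, ← Lp.enorm_def, ← ofReal_norm, ← ofReal_norm]
    congr 1
    exact (Lp.fourierTransformₗᵢ R3 (EuclideanSpace ℂ ι)).symm.norm_map _
  have hhigh : eLpNorm (h - l : CField ι) 2 volume ^ 2 =
      ∫⁻ ξ, Set.indicator {ξ | s < 2 * B * sobWeight ξ} (fun ξ => ‖h ξ‖ₑ ^ 2) ξ := by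
    rw [eLpNorm_two_sq]
    refine lintegral_congr_ae ?_
    filter_upwards [Lp.coeFn_sub h l, coeFn_mulOp (isSymbol_lowPass A) h] with ξ h1 h2
    rw [h1, Pi.sub_apply, h2, lowPass]
    have hiff : sobWeight ξ ≤ A ↔ ¬ s < 2 * B * sobWeight ξ := by
      rw [hA, le_div_iff₀ (by positivity), not_lt, mul_comm]
    by_cases hs' : s < 2 * B * sobWeight ξ
    · simp [Set.indicator, hiff, hs']
    · simp [Set.indicator, hiff, hs']
  rw [hpl] at hcheb
  simp only [ENNReal.toReal_ofNat, ENNReal.rpow_ofNat, hhigh] at hcheb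
  have h4 : ENNReal.ofReal (s ^ 2) = 4 * ENNReal.ofReal (s / 2) ^ 2 := by
    rw [← ENNReal.ofReal_pow (by positivity), ← ENNReal.ofReal_ofNat 4,
      ← ENNReal.ofReal_mul (by norm_num)]
    congr 1
    ring
  rw [h4, mul_comm, mul_assoc]
  gcongr
  exact (mul_le_mul_right hle _).trans hcheb

/-- Integrating the bound on the distribution function against `s ds`, and exchanging the
integrals, leaves `∫_0^{2Bw(ξ)} s ds`, that is, the weight `w(ξ)²` of the `H¹` norm. -/
lemma lintegral_fourierInv_pow_four_le (h : CField ι) {B : ℝ} (hB : 0 < B)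
    (hN : eLpNorm (fun ξ => sobWeight ξ • h ξ) 2 volume ≠ ⊤)
    (hNB : eLpNorm (fun ξ => (sobWeight ξ ^ 2)⁻¹) 2 (volume : Measure R3) *
        eLpNorm (fun ξ => sobWeight ξ • h ξ) 2 volume ≤ ENNReal.ofReal B) :
    ∫⁻ x, ‖(𝓕⁻ h : CField ι) x‖ₑ ^ 4 ≤
      ENNReal.ofReal (64 * B ^ 2) * eLpNorm (fun ξ => sobWeight ξ • h ξ) 2 volume ^ 2 := by
  have hlayer := lintegral_rpow_eq_lintegral_meas_le_mul (volume : Measure R3)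
    (f := fun x => ‖(𝓕⁻ h : CField ι) x‖) (Eventually.of_forall fun x => norm_nonneg _)
    (Lp.aestronglyMeasurable _).norm.aemeasurable (p := 4) (by norm_num)
  have hlhs : ∫⁻ x, ‖(𝓕⁻ h : CField ι) x‖ₑ ^ 4 =
      ∫⁻ x, ENNReal.ofReal (‖(𝓕⁻ h : CField ι) x‖ ^ (4 : ℝ)) := by
    refine lintegral_congr fun x => ?_
    rw [← ofReal_norm, ← ENNReal.ofReal_pow (norm_nonneg _)]
    norm_cast
  set φ : ℝ → R3 → ENNReal := fun s ξ =>
    Set.indicator {p : ℝ × R3 | p.1 < 2 * B * sobWeight p.2}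
      (fun p => ‖h p.2‖ₑ ^ 2 * ENNReal.ofReal p.1) (s, ξ) with hφ
  have hφm : Measurable (Function.uncurry φ) := by
    refine Measurable.indicator ?_ (measurableSet_lt measurable_fst
      (continuous_sobWeight.measurable.comp measurable_snd |>.const_mul _))
    exact (((Lp.stronglyMeasurable h).enorm.comp measurable_snd).pow_const 2).mul
      (ENNReal.measurable_ofReal.comp measurable_fst)
  have hpt : ∀ s ∈ Set.Ioi (0 : ℝ), volume {x | s ≤ ‖(𝓕⁻ h : CField ι) x‖} *
      ENNReal.ofReal (s ^ ((4 : ℝ) - 1)) ≤ 4 * ∫⁻ ξ, φ s ξ := by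
    intro s hs
    have hs0 : (0 : ℝ) < s := hs
    have h3 : ENNReal.ofReal (s ^ ((4 : ℝ) - 1)) = ENNReal.ofReal (s ^ 2) * ENNReal.ofReal s := by
      rw [← ENNReal.ofReal_mul (by positivity), show (4 : ℝ) - 1 = ((3 : ℕ) : ℝ) by norm_num,
        Real.rpow_natCast]
      congr 1
    rw [h3, ← mul_assoc]
    refine (mul_le_mul_left (measure_le_norm_fourierInv h hB hN hNB hs0) _).trans ?_
    rw [mul_assoc, ← lintegral_mul_const']
    · refine mul_le_mul_right (lintegral_mono fun ξ => ?_) _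
      simp only [hφ, Set.indicator, Set.mem_ofPred_eq]
      split_ifs <;> simp
    · exact ENNReal.ofReal_ne_top
  have hinner : ∀ ξ, ∫⁻ s in Set.Ioi (0 : ℝ), φ s ξ ≤
      ENNReal.ofReal (4 * B ^ 2) * ‖sobWeight ξ • h ξ‖ₑ ^ 2 := by
    intro ξ
    have hw := sobWeight_pos ξ
    set c := 2 * B * sobWeight ξ with hc
    calc ∫⁻ s in Set.Ioi (0 : ℝ), φ s ξ
        ≤ ∫⁻ s in Set.Ioi (0 : ℝ), Set.indicator (Set.Iio c)
            (fun _ => ‖h ξ‖ₑ ^ 2 * ENNReal.ofReal c) s := by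
          refine lintegral_mono fun s => ?_
          simp only [hφ, Set.indicator, Set.mem_ofPred_eq, Set.mem_Iio]
          split_ifs with h1
          · gcongr
          · exact le_rfl
      _ = ‖h ξ‖ₑ ^ 2 * ENNReal.ofReal c * ENNReal.ofReal c := by
          rw [lintegral_indicator measurableSet_Iio, Measure.restrict_restrict measurableSet_Iio,
            lintegral_const, Measure.restrict_apply_univ, Set.Iio_inter_Ioi, Real.volume_Ioo,
            sub_zero]
      _ = ENNReal.ofReal (4 * B ^ 2) * ‖sobWeight ξ • h ξ‖ₑ ^ 2 := by
          rw [enorm_smul, Real.enorm_eq_ofReal hw.le, mul_pow, mul_assoc,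
            ← ENNReal.ofReal_mul (by positivity), ← ENNReal.ofReal_pow hw.le,
            ← mul_assoc (ENNReal.ofReal (4 * B ^ 2)), ← ENNReal.ofReal_mul (by positivity),
            mul_comm]
          congr 2
          rw [hc]; ring
  have hwm : Measurable fun ξ => ‖sobWeight ξ • h ξ‖ₑ ^ 2 :=
    ((continuous_sobWeight.stronglyMeasurable.smul (Lp.stronglyMeasurable h)).enorm).pow_const 2
  calc ∫⁻ x, ‖(𝓕⁻ h : CField ι) x‖ₑ ^ 4
      = ENNReal.ofReal 4 * ∫⁻ s in Set.Ioi (0 : ℝ), volume {x | s ≤ ‖(𝓕⁻ h : CField ι) x‖} *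
          ENNReal.ofReal (s ^ ((4 : ℝ) - 1)) := by rw [hlhs, hlayer]
    _ ≤ ENNReal.ofReal 4 * ∫⁻ s in Set.Ioi (0 : ℝ), 4 * ∫⁻ ξ, φ s ξ := by
        gcongr 1
        exact setLIntegral_mono' measurableSet_Ioi hpt
    _ = ENNReal.ofReal 16 * ∫⁻ ξ, ∫⁻ s in Set.Ioi (0 : ℝ), φ s ξ := by
        rw [lintegral_const_mul' _ _ (by norm_num), ← mul_assoc,
          lintegral_lintegral_swap hφm.aemeasurable, ← ENNReal.ofReal_ofNat 4,
          ← ENNReal.ofReal_mul (by norm_num)]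
        norm_num
    _ ≤ ENNReal.ofReal 16 * ∫⁻ ξ, ENNReal.ofReal (4 * B ^ 2) * ‖sobWeight ξ • h ξ‖ₑ ^ 2 := by
        gcongr 1
        exact lintegral_mono hinner
    _ = _ := by
        rw [lintegral_const_mul _ hwm, eLpNorm_two_sq, ← mul_assoc,
          ← ENNReal.ofReal_mul (by norm_num)]
        congr 2
        ring

lemma sobolevNorm_one_eq (f : L2Field ι) :
    sobolevNorm 1 f = eLpNorm (fun ξ => sobWeight ξ • fourierL2 f ξ) 2 volume := by
  simp only [sobolevNorm, sobWeight_eq_rpow]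

/-- The Sobolev embedding `H¹(ℝ³) ⊆ L⁴(ℝ³)`. -/
lemma exists_eLpNorm_four_le (ι : Type) [Fintype ι] : ∃ K : ℝ, 0 < K ∧ ∀ f : L2Field ι,
    eLpNorm f 4 volume ≤ ENNReal.ofReal K * sobolevNorm 1 f := by
  set C : ENNReal := eLpNorm (fun ξ => (sobWeight ξ ^ 2)⁻¹) 2 (volume : Measure R3) with hC
  have hCtop : C ≠ ⊤ := memLp_sobWeight_inv_sq.2.ne
  set c : ℝ := C.toReal + 1 with hc
  have hc1 : 1 ≤ c := by have := ENNReal.toReal_nonneg (a := C); linarith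
  have hCc : C ≤ ENNReal.ofReal c :=
    (ENNReal.le_ofReal_iff_toReal_le hCtop (by positivity)).2 (by linarith)
  refine ⟨64 * c ^ 2, by positivity, fun f => ?_⟩
  by_cases htop : sobolevNorm 1 f = ⊤
  · rw [htop, ENNReal.mul_top (by simp; positivity)]
    exact le_top
  have hf : eLpNorm f 4 volume =
      eLpNorm (𝓕⁻ (fourierL2 f) : CField ι) 4 volume := by
    have h1 : (𝓕⁻ (fourierL2 f) : CField ι) = (complexify ι).compLp f :=
      (Lp.fourierTransformₗᵢ R3 (EuclideanSpace ℂ ι)).symm_apply_apply _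
    rw [h1]
    refine eLpNorm_congr_norm_ae ?_
    filter_upwards [(complexify ι).coeFn_compLp f] with x hx
    rw [hx, norm_complexify]
  -- a strict upper bound `n` of the norm is positive, also when `f = 0`
  have key : ∀ n : ℝ, (sobolevNorm 1 f).toReal < n →
      eLpNorm f 4 volume ≤ ENNReal.ofReal (64 * c ^ 2 * n) := by
    intro n hn
    have hn0 : 0 < n := ENNReal.toReal_nonneg.trans_lt hn
    have hN : sobolevNorm 1 f ≤ ENNReal.ofReal n :=
      (ENNReal.le_ofReal_iff_toReal_le htop hn0.le).2 hn.le
    rw [sobolevNorm_one_eq] at hN htop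
    have h1 := lintegral_fourierInv_pow_four_le (fourierL2 f) (B := c * n) (by positivity) htop
      (by rw [ENNReal.ofReal_mul (by positivity)]; exact mul_le_mul' hCc hN)
    rw [← eLpNorm_four_pow, ← hf] at h1
    have h2 : eLpNorm f 4 volume ^ 4 ≤ ENNReal.ofReal (64 * c ^ 2 * n) ^ 4 := by
      refine h1.trans ((mul_le_mul_right (pow_le_pow_left' hN 2) _).trans ?_)
      rw [← ENNReal.ofReal_pow hn0.le, ← ENNReal.ofReal_mul (by positivity),
        ← ENNReal.ofReal_pow (by positivity)]
      refine ENNReal.ofReal_le_ofReal ?_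
      have h3 : (1 : ℝ) ≤ 64 * c ^ 2 := by nlinarith
      have h4 : 64 * c ^ 2 * 1 ≤ 64 * c ^ 2 * (64 * c ^ 2) ^ 3 :=
        mul_le_mul_of_nonneg_left (one_le_pow₀ h3) (by positivity)
      calc 64 * (c * n) ^ 2 * n ^ 2 = (64 * c ^ 2 * 1) * n ^ 4 := by ring
        _ ≤ (64 * c ^ 2 * (64 * c ^ 2) ^ 3) * n ^ 4 := by gcongr
        _ = _ := by ring
    exact (ENNReal.pow_le_pow_left_iff four_ne_zero).1 h2
  have hlim : Tendsto (fun n : ℝ => ENNReal.ofReal (64 * c ^ 2 * n))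
      (𝓝[>] (sobolevNorm 1 f).toReal) (𝓝 (ENNReal.ofReal (64 * c ^ 2) * sobolevNorm 1 f)) := by
    have h1 : ENNReal.ofReal (64 * c ^ 2) * sobolevNorm 1 f =
        ENNReal.ofReal (64 * c ^ 2 * (sobolevNorm 1 f).toReal) := by
      rw [ENNReal.ofReal_mul (p := 64 * c ^ 2) (by positivity), ENNReal.ofReal_toReal htop]
    rw [h1]
    exact tendsto_nhdsWithin_of_tendsto_nhds
      ((ENNReal.continuous_ofReal.comp (continuous_const_mul _)).tendsto _)
  exact ge_of_tendsto hlim (eventually_nhdsWithin_of_forall fun n hn => key n hn)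

/-! ### Strain fields -/

/-- A complex linear relation between the components of `f̂` passes to `f`. -/
lemma ae_eq_zero_of_fourierL2 (L : EuclideanSpace ℂ ι →L[ℂ] ℂ)
    {f : L2Field ι} (h : ∀ᵐ ξ, L (fourierL2 f ξ) = 0) : ∀ᵐ x, L (complexify ι (f x)) = 0 := by
  have h1 : (L.compLp (fourierL2 f) : Lp ℂ 2 (volume : Measure R3)) = 0 := by
    ext1
    filter_upwards [L.coeFn_compLp (fourierL2 f), h, Lp.coeFn_zero ℂ 2 (volume : Measure R3)]
      with ξ h1 h2 h3
    rw [h1, h2, h3, Pi.zero_apply]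
  rw [fourierL2, ← fourier_compLp] at h1
  have h2 : (L.compLp ((complexify ι).compLp f : CField ι) : Lp ℂ 2 (volume : Measure R3)) = 0 :=
    (Lp.fourierTransformₗᵢ R3 ℂ).map_eq_zero_iff.1 h1
  have h3 := L.coeFn_compLp ((complexify ι).compLp f : CField ι)
  rw [h2] at h3
  filter_upwards [h3, (complexify ι).coeFn_compLp f, Lp.coeFn_zero ℂ 2 (volume : Measure R3)]
    with x h4 h5 h6
  rw [← h5, ← h4, h6, Pi.zero_apply]

lemma ae_symm_of_mem_Hst {s : ℝ} {S : MatrixField} (hS : S ∈ Hst s) :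
    ∀ᵐ x, ∀ i j, S x (i, j) = S x (j, i) := by
  obtain ⟨u, -, hu⟩ := hS
  simp only [ae_all_iff]
  intro i j
  have h := ae_eq_zero_of_fourierL2 (f := S)
    ((EuclideanSpace.proj (i, j) : EuclideanSpace ℂ (Fin 3 × Fin 3) →L[ℂ] ℂ) -
      EuclideanSpace.proj (j, i)) (by
      filter_upwards [hu i j, hu j i] with ξ h1 h2
      simp only [_root_.sub_apply, PiLp.proj_apply, h1, h2]
      ring)
  filter_upwards [h] with x hx
  simp only [_root_.sub_apply, PiLp.proj_apply, complexify_apply, sub_eq_zero] at hx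
  exact_mod_cast hx

lemma ae_trace_of_mem_Hst {s : ℝ} {S : MatrixField} (hS : S ∈ Hst s) :
    ∀ᵐ x, ∑ i, S x (i, i) = 0 := by
  obtain ⟨u, ⟨-, hdiv⟩, hu⟩ := hS
  have hu' : ∀ᵐ ξ : R3, ∀ i, fourierL2 S ξ (i, i) = _ := ae_all_iff.2 fun i => hu i i
  have h := ae_eq_zero_of_fourierL2 (f := S)
    (∑ i : Fin 3, (EuclideanSpace.proj (i, i) : EuclideanSpace ℂ (Fin 3 × Fin 3) →L[ℂ] ℂ)) (by
      filter_upwards [hu', hdiv] with ξ h1 h2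
      simp only [_root_.sum_apply, PiLp.proj_apply, h1]
      calc _ = 2 * Real.pi * Complex.I / ((2 * Real.pi * ‖ξ‖ : ℝ) : ℂ) *
            ∑ i : Fin 3, (ξ i : ℂ) * fourierL2 u ξ i := by
              rw [Finset.mul_sum]
              exact Finset.sum_congr rfl fun i _ => by ring
        _ = 0 := by rw [h2, mul_zero])
  filter_upwards [h] with x hx
  simp only [_root_.sum_apply, PiLp.proj_apply, complexify_apply] at hx
  exact_mod_cast hx

lemma mem_Hst_zero {S : MatrixField} (hS : S ∈ Hst 1) : S ∈ Hst 0 := by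
  obtain ⟨u, ⟨-, hdiv⟩, hu⟩ := hS
  refine ⟨u, ⟨?_, hdiv⟩, hu⟩
  simp only [sobolevNorm, mul_zero, Real.rpow_zero]
  exact ((Lp.memLp (fourierL2 u)).const_smul ((1 + 1 : ℝ) ^ (1 / 2 : ℝ))).2

/-- The symbols of the Riesz transforms have modulus at most one; at `ξ = 0` the left side is the
junk value `0`. -/
lemma norm_riesz_le (ξ : R3) (i : Fin 3) (z : ℂ) :
    ‖2 * Real.pi * Complex.I * ξ i * (z / (2 * Real.pi * ‖ξ‖ : ℝ))‖ ≤ ‖z‖ := by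
  have h : ‖2 * Real.pi * Complex.I * ξ i * (z / (2 * Real.pi * ‖ξ‖ : ℝ))‖ =
      (2 * Real.pi * |ξ i|) / (2 * Real.pi * ‖ξ‖) * ‖z‖ := by
    simp only [norm_mul, norm_div, Complex.norm_I, Complex.norm_real, Complex.norm_ofNat,
      Real.norm_eq_abs, abs_of_pos Real.pi_pos]
    rw [abs_two, abs_norm]
    ring
  rw [h]
  refine mul_le_of_le_one_left (norm_nonneg _) (div_le_one_of_le₀ ?_ (by positivity))
  have : |ξ i| ≤ ‖ξ‖ := by simpa using PiLp.norm_apply_le ξ i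
  gcongr

lemma sobolevNorm_lt_top_of_mem_Hst {S : MatrixField} (hS : S ∈ Hst 1) :
    sobolevNorm 1 S < ⊤ := by
  obtain ⟨u, ⟨hfin, -⟩, hu⟩ := hS
  rw [sobolevNorm_one_eq] at hfin ⊢
  have hu' : ∀ᵐ ξ : R3, ∀ i j, fourierL2 S ξ (i, j) = _ :=
    ae_all_iff.2 fun i => ae_all_iff.2 fun j => hu i j
  refine (eLpNorm_le_mul_eLpNorm_of_ae_le_mul (c := 3) ?_ 2).trans_lt
    (ENNReal.mul_lt_top ENNReal.ofReal_lt_top hfin)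
  filter_upwards [hu'] with ξ h
  have h1 : ∀ p, ‖fourierL2 S ξ p‖ ≤ ‖fourierL2 u ξ‖ := by
    rintro ⟨i, j⟩
    rw [h i j]
    have h2 := norm_riesz_le ξ i (fourierL2 u ξ j)
    have h3 := norm_riesz_le ξ j (fourierL2 u ξ i)
    have h4 := PiLp.norm_apply_le (fourierL2 u ξ) i
    have h5 := PiLp.norm_apply_le (fourierL2 u ξ) j
    rw [norm_mul, show ‖(1 / 2 : ℂ)‖ = 1 / 2 by norm_num]
    have h6 := norm_add_le
        (2 * Real.pi * Complex.I * ξ i * (fourierL2 u ξ j / (2 * Real.pi * ‖ξ‖ : ℝ)))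
        (2 * Real.pi * Complex.I * ξ j * (fourierL2 u ξ i / (2 * Real.pi * ‖ξ‖ : ℝ)))
    linarith
  have h2 : ‖fourierL2 S ξ‖ ≤ 3 * ‖fourierL2 u ξ‖ := by
    rw [EuclideanSpace.norm_eq]
    refine Real.sqrt_le_iff.2 ⟨by positivity, ?_⟩
    calc ∑ p, ‖fourierL2 S ξ p‖ ^ 2 ≤ ∑ _p : Fin 3 × Fin 3, ‖fourierL2 u ξ‖ ^ 2 :=
          Finset.sum_le_sum fun p _ => pow_le_pow_left₀ (norm_nonneg _) (h1 p) 2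
      _ = _ := by simp; ring
  rw [norm_smul, norm_smul]
  nlinarith [norm_nonneg (sobWeight ξ)]

/-! ### The `H¹` norm -/

/-- The `H¹` norm as a real number; the junk value `0` occurs only outside `H¹`. -/
def h1Norm (f : L2Field ι) : ℝ := (sobolevNorm 1 f).toReal

lemma h1Norm_nonneg (f : L2Field ι) : 0 ≤ h1Norm f := ENNReal.toReal_nonneg

lemma sobolevNorm_add_le (f g : L2Field ι) :
    sobolevNorm 1 (f + g) ≤ sobolevNorm 1 f + sobolevNorm 1 g := by
  have hm := fun f : L2Field ι => aestronglyMeasurable_weight 1 f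
  refine le_trans (le_of_eq (eLpNorm_congr_ae ?_)) (eLpNorm_add_le (hm f) (hm g) (by norm_num))
  rw [fourierL2_add]
  filter_upwards [Lp.coeFn_add (fourierL2 f) (fourierL2 g)] with ξ h
  simp only [h, Pi.add_apply, smul_add]

lemma h1Norm_le_add (f g : L2Field ι) (hf : sobolevNorm 1 f < ⊤) (hg : sobolevNorm 1 (g - f) < ⊤) :
    h1Norm g ≤ h1Norm f + h1Norm (g - f) := by
  rw [h1Norm, h1Norm, h1Norm, ← ENNReal.toReal_add hf.ne hg.ne]
  refine ENNReal.toReal_mono (ENNReal.add_ne_top.2 ⟨hf.ne, hg.ne⟩) ?_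
  simpa using sobolevNorm_add_le f (g - f)

lemma aestronglyMeasurable_homWeight (f : L2Field ι) :
    AEStronglyMeasurable (fun ξ : R3 => (2 * Real.pi * ‖ξ‖) • fourierL2 f ξ) volume := by
  have h : Continuous fun ξ : R3 => 2 * Real.pi * ‖ξ‖ := by fun_prop
  exact h.aestronglyMeasurable.smul (Lp.aestronglyMeasurable (fourierL2 f))

lemma homSobolevNorm_one_eq (f : L2Field ι) : homSobolevNorm 1 f =
    (eLpNorm (fun ξ => (2 * Real.pi * ‖ξ‖) • fourierL2 f ξ) 2 volume).toReal := by
  simp only [homSobolevNorm, Real.rpow_one]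

lemma eLpNorm_homWeight_le (f : L2Field ι) :
    eLpNorm (fun ξ => (2 * Real.pi * ‖ξ‖) • fourierL2 f ξ) 2 volume ≤ sobolevNorm 1 f := by
  rw [sobolevNorm_one_eq]
  refine eLpNorm_mono fun ξ => ?_
  rw [norm_smul, norm_smul]
  refine mul_le_mul_of_nonneg_right ?_ (norm_nonneg _)
  rw [Real.norm_of_nonneg (by positivity), Real.norm_of_nonneg (sobWeight_pos ξ).le]
  exact Real.le_sqrt_of_sq_le (by linarith)

/-- The `Ḣ¹` norm is `1`-Lipschitz for the `H¹` distance. -/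
lemma homSobolevNorm_le_add (f g : L2Field ι) (hf : sobolevNorm 1 f < ⊤)
    (hg : sobolevNorm 1 (g - f) < ⊤) :
    homSobolevNorm 1 g ≤ homSobolevNorm 1 f + h1Norm (g - f) := by
  have h1 := (eLpNorm_homWeight_le f).trans_lt hf
  rw [homSobolevNorm_one_eq, homSobolevNorm_one_eq, h1Norm, ← ENNReal.toReal_add h1.ne hg.ne]
  refine ENNReal.toReal_mono (ENNReal.add_ne_top.2 ⟨h1.ne, hg.ne⟩) ?_
  refine le_trans ?_ (add_le_add_right (eLpNorm_homWeight_le (g - f)) _)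
  refine le_trans (le_of_eq (eLpNorm_congr_ae ?_)) (eLpNorm_add_le
    (aestronglyMeasurable_homWeight f) (aestronglyMeasurable_homWeight (g - f)) (by norm_num))
  rw [fourierL2_sub]
  filter_upwards [Lp.coeFn_sub (fourierL2 g) (fourierL2 f)] with ξ h
  simp only [h, Pi.add_apply, Pi.sub_apply, ← smul_add, add_sub_cancel]

lemma norm_le_h1Norm (f : L2Field ι) (hf : sobolevNorm 1 f < ⊤) : ‖f‖ ≤ h1Norm f := by
  rw [← norm_fourierL2, Lp.norm_def, h1Norm]
  refine ENNReal.toReal_mono hf.ne ?_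
  rw [sobolevNorm_one_eq]
  refine eLpNorm_mono fun ξ => ?_
  rw [norm_smul, Real.norm_of_nonneg (sobWeight_pos ξ).le]
  exact le_mul_of_one_le_left (norm_nonneg _) (one_le_sobWeight ξ)

/-! ### The matrix square -/

/-- The matrix product on lists of entries. -/
def matMul (v w : EuclideanSpace ℝ (Fin 3 × Fin 3)) : EuclideanSpace ℝ (Fin 3 × Fin 3) :=
  ofMat (toMat v * toMat w)

lemma matMul_apply (v w : EuclideanSpace ℝ (Fin 3 × Fin 3)) (p : Fin 3 × Fin 3) :
    matMul v w p = ∑ k, v (p.1, k) * w (k, p.2) := rfl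

/-- The Frobenius norm is submultiplicative. -/
lemma norm_matMul_le (v w : EuclideanSpace ℝ (Fin 3 × Fin 3)) :
    ‖matMul v w‖ ≤ ‖v‖ * ‖w‖ := by
  refine le_of_sq_le_sq ?_ (by positivity)
  rw [mul_pow, EuclideanSpace.norm_sq_eq, EuclideanSpace.norm_sq_eq, EuclideanSpace.norm_sq_eq]
  simp only [Real.norm_eq_abs, sq_abs, Fintype.sum_prod_type, matMul_apply]
  calc ∑ i, ∑ j, (∑ k, v (i, k) * w (k, j)) ^ 2
      ≤ ∑ i, ∑ j, (∑ k, v (i, k) ^ 2) * ∑ k, w (k, j) ^ 2 :=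
        Finset.sum_le_sum fun i _ => Finset.sum_le_sum fun j _ =>
          Finset.sum_mul_sq_le_sq_mul_sq _ _ _
    _ = (∑ i, ∑ k, v (i, k) ^ 2) * ∑ k, ∑ j, w (k, j) ^ 2 := by
        rw [Finset.sum_comm (f := fun k j => w (k, j) ^ 2), Finset.sum_mul]
        exact Finset.sum_congr rfl fun i _ => by rw [Finset.mul_sum]

lemma continuous_matMul : Continuous fun p : EuclideanSpace ℝ (Fin 3 × Fin 3) ×
    EuclideanSpace ℝ (Fin 3 × Fin 3) => matMul p.1 p.2 := by
  unfold matMul ofMat toMat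
  refine (PiLp.continuous_toLp 2 _).comp (continuous_pi fun p => ?_)
  simp only [Matrix.mul_apply, Matrix.of_apply]
  fun_prop

lemma aestronglyMeasurable_matMul {f g : R3 → EuclideanSpace ℝ (Fin 3 × Fin 3)}
    (hf : AEStronglyMeasurable f volume) (hg : AEStronglyMeasurable g volume) :
    AEStronglyMeasurable (fun x => matMul (f x) (g x)) (volume : Measure R3) :=
  continuous_matMul.comp_aestronglyMeasurable (hf.prodMk hg)

instance holderTriple_four_four_two : ENNReal.HolderTriple 4 4 2 where
  inv_add_inv_eq_inv := by
    rw [show (4 : ENNReal) = 2 * 2 by norm_num, ENNReal.mul_inv (by simp) (by simp), ← mul_add,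
      ENNReal.inv_two_add_inv_two, mul_one]

lemma eLpNorm_matMul_le {f g : R3 → EuclideanSpace ℝ (Fin 3 × Fin 3)}
    (hf : AEStronglyMeasurable f volume) (hg : AEStronglyMeasurable g volume) :
    eLpNorm (fun x => matMul (f x) (g x)) 2 (volume : Measure R3) ≤
      eLpNorm f 4 volume * eLpNorm g 4 volume := by
  have h := eLpNorm_smul_le_mul_eLpNorm (p := 4) (q := 4) (r := 2) hg.norm hf.norm
  rw [eLpNorm_norm, eLpNorm_norm] at h
  refine le_trans (eLpNorm_mono fun x => ?_) h
  rw [Pi.smul_apply', smul_eq_mul, Real.norm_of_nonneg (by positivity)]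
  exact norm_matMul_le _ _

/-- A constant for the Sobolev embedding `H¹ ⊆ L⁴`. -/
def sobolevConst : ℝ := (exists_eLpNorm_four_le (Fin 3 × Fin 3)).choose

lemma sobolevConst_pos : 0 < sobolevConst :=
  (exists_eLpNorm_four_le (Fin 3 × Fin 3)).choose_spec.1

lemma eLpNorm_four_le (f : MatrixField) (hf : sobolevNorm 1 f < ⊤) :
    eLpNorm f 4 volume ≤ ENNReal.ofReal (sobolevConst * h1Norm f) := by
  rw [ENNReal.ofReal_mul sobolevConst_pos.le, h1Norm, ENNReal.ofReal_toReal hf.ne]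
  exact (exists_eLpNorm_four_le (Fin 3 × Fin 3)).choose_spec.2 f

lemma eLpNorm_matMul_le_h1Norm (f g : MatrixField) (hf : sobolevNorm 1 f < ⊤)
    (hg : sobolevNorm 1 g < ⊤) :
    eLpNorm (fun x => matMul (f x) (g x)) 2 (volume : Measure R3) ≤
      ENNReal.ofReal (sobolevConst ^ 2 * (h1Norm f * h1Norm g)) := by
  refine (eLpNorm_matMul_le (Lp.aestronglyMeasurable f) (Lp.aestronglyMeasurable g)).trans ?_
  refine (mul_le_mul' (eLpNorm_four_le f hf) (eLpNorm_four_le g hg)).trans (le_of_eq ?_)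
  rw [← ENNReal.ofReal_mul (mul_nonneg sobolevConst_pos.le (h1Norm_nonneg f))]
  congr 1
  ring

lemma memLp_sqField (S : MatrixField) (hS : sobolevNorm 1 S < ⊤) :
    MemLp (sqField S) 2 (volume : Measure R3) :=
  ⟨aestronglyMeasurable_matMul (Lp.aestronglyMeasurable S) (Lp.aestronglyMeasurable S),
    (eLpNorm_matMul_le_h1Norm S S hS hS).trans_lt ENNReal.ofReal_lt_top⟩

lemma coeFn_sqL2 (S : MatrixField) (hS : sobolevNorm 1 S < ⊤) :
    sqL2 S =ᵐ[volume] fun x => matMul (S x) (S x) := by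
  rw [sqL2, dif_pos (memLp_sqField S hS)]
  exact MemLp.coeFn_toLp _

lemma norm_sqL2_le (S : MatrixField) (hS : sobolevNorm 1 S < ⊤) :
    ‖sqL2 S‖ ≤ sobolevConst ^ 2 * h1Norm S ^ 2 := by
  rw [Lp.norm_def, eLpNorm_congr_ae (coeFn_sqL2 S hS), pow_two (h1Norm S)]
  exact ENNReal.toReal_le_of_le_ofReal
    (mul_nonneg (sq_nonneg _) (mul_nonneg (h1Norm_nonneg S) (h1Norm_nonneg S)))
    (eLpNorm_matMul_le_h1Norm S S hS hS)

/-- `A² - B² = A (A - B) + (A - B) B`, with both products in `L²` by the Sobolev embedding. -/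
lemma norm_sqL2_sub_le (A B : MatrixField) (hA : sobolevNorm 1 A < ⊤) (hB : sobolevNorm 1 B < ⊤)
    (hAB : sobolevNorm 1 (A - B) < ⊤) :
    ‖sqL2 A - sqL2 B‖ ≤ sobolevConst ^ 2 * ((h1Norm A + h1Norm B) * h1Norm (A - B)) := by
  have hpos : ∀ f : MatrixField, 0 ≤ h1Norm f := h1Norm_nonneg
  have hae : (sqL2 A - sqL2 B : MatrixField) =ᵐ[volume]
      (fun x => matMul (A x) ((A - B : MatrixField) x)) +
        fun x => matMul ((A - B : MatrixField) x) (B x) := by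
    filter_upwards [Lp.coeFn_sub (sqL2 A) (sqL2 B), Lp.coeFn_sub A B, coeFn_sqL2 A hA,
      coeFn_sqL2 B hB] with x h1 h2 h3 h4
    rw [h1, Pi.sub_apply, Pi.add_apply, h2, h3, h4, Pi.sub_apply]
    ext p
    simp only [PiLp.sub_apply, PiLp.add_apply, matMul_apply, ← Finset.sum_sub_distrib,
      ← Finset.sum_add_distrib]
    exact Finset.sum_congr rfl fun k _ => by ring
  rw [Lp.norm_def, eLpNorm_congr_ae hae]
  refine ENNReal.toReal_le_of_le_ofReal
    (mul_nonneg (sq_nonneg _) (mul_nonneg (add_nonneg (hpos _) (hpos _)) (hpos _))) ?_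
  have h1 : AEStronglyMeasurable (fun x => matMul (A x) ((A - B : MatrixField) x)) volume :=
    aestronglyMeasurable_matMul (Lp.aestronglyMeasurable A) (Lp.aestronglyMeasurable (A - B))
  have h2 : AEStronglyMeasurable (fun x => matMul ((A - B : MatrixField) x) (B x)) volume :=
    aestronglyMeasurable_matMul (Lp.aestronglyMeasurable (A - B)) (Lp.aestronglyMeasurable B)
  have h3 := eLpNorm_add_le h1 h2 (p := 2) (by norm_num)
  refine h3.trans ?_
  refine (add_le_add (eLpNorm_matMul_le_h1Norm _ _ hA hAB)
    (eLpNorm_matMul_le_h1Norm _ _ hAB hB)).trans (le_of_eq ?_)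
  rw [← ENNReal.ofReal_add]
  · congr 1
    ring
  · exact mul_nonneg (sq_nonneg _) (mul_nonneg (hpos _) (hpos _))
  · exact mul_nonneg (sq_nonneg _) (mul_nonneg (hpos _) (hpos _))

/-! ### The determinant -/

/-- `det A = tr(A³) / 3` for symmetric trace free matrices. -/
lemma detField_ae_eq {S : MatrixField} (hS : S ∈ Hst 1) :
    detField S =ᵐ[volume] fun x => 1 / 3 * inner ℝ (sqL2 S x) (S x) := by
  filter_upwards [coeFn_sqL2 S (sobolevNorm_lt_top_of_mem_Hst hS), ae_symm_of_mem_Hst hS,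
    ae_trace_of_mem_Hst hS] with x h1 h2 h3
  rw [h1, detField, Matrix.det_fin_three]
  simp only [toMat, Matrix.of_apply, PiLp.inner_apply, RCLike.inner_apply, conj_trivial,
    Fintype.sum_prod_type, Fin.sum_univ_three, matMul_apply] at h3 ⊢
  have h22 : S x (2, 2) = -(S x (0, 0) + S x (1, 1)) := by linarith
  rw [h22, h2 1 0, h2 2 0, h2 2 1]
  ring

lemma integrable_detField {S : MatrixField} (hS : S ∈ Hst 1) : Integrable (detField S) :=
  ((L2.integrable_inner (sqL2 S) S).const_mul (1 / 3)).congr (detField_ae_eq hS).symm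

lemma integral_detField {S : MatrixField} (hS : S ∈ Hst 1) :
    ∫ x, detField S x = 1 / 3 * inner ℝ (sqL2 S) S := by
  rw [integral_congr_ae (detField_ae_eq hS), integral_const_mul, L2.inner_def]

/-- Expansion of `∫ tr(S³)` around `A`; the last two terms are of higher order in `B - A`. -/
lemma inner_sqL2_sub_inner_sqL2 {A B : MatrixField} (hA : A ∈ Hst 1) (hB : B ∈ Hst 1) :
    inner ℝ (sqL2 B) B - inner ℝ (sqL2 A) A =
      3 * inner ℝ (sqL2 A) (B - A) + 3 / 2 * inner ℝ (sqL2 B - sqL2 A) (B - A) -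
        1 / 2 * inner ℝ (sqL2 (B - A)) (B - A) := by
  have hAB : B - A ∈ Hst 1 := sub_mem hB hA
  have hi := fun f g : MatrixField => L2.integrable_inner (𝕜 := ℝ) f g
  simp only [L2.inner_def]
  have h12 : Integrable (fun x => 3 * inner ℝ (sqL2 A x) ((B - A : MatrixField) x) +
      3 / 2 * inner ℝ ((sqL2 B - sqL2 A : MatrixField) x) ((B - A : MatrixField) x)) :=
    ((hi _ _).const_mul _).add ((hi _ _).const_mul _)
  rw [← integral_const_mul, ← integral_const_mul, ← integral_const_mul,
    ← integral_sub (hi _ _) (hi _ _), ← integral_add ((hi _ _).const_mul _) ((hi _ _).const_mul _),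
    ← integral_sub h12 ((hi _ _).const_mul _)]
  refine integral_congr_ae ?_
  filter_upwards [coeFn_sqL2 A (sobolevNorm_lt_top_of_mem_Hst hA),
    coeFn_sqL2 B (sobolevNorm_lt_top_of_mem_Hst hB),
    coeFn_sqL2 (B - A) (sobolevNorm_lt_top_of_mem_Hst hAB), ae_symm_of_mem_Hst hA,
    ae_symm_of_mem_Hst hB, Lp.coeFn_sub B A, Lp.coeFn_sub (sqL2 B) (sqL2 A)]
    with x h1 h2 h3 h4 h5 h6 h7
  rw [h7, h3, h6, Pi.sub_apply, Pi.sub_apply, h1, h2]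
  simp only [PiLp.inner_apply, RCLike.inner_apply, conj_trivial, PiLp.sub_apply,
    Fintype.sum_prod_type, Fin.sum_univ_three, matMul_apply]
  rw [h4 1 0, h4 2 0, h4 2 1, h5 1 0, h5 2 0, h5 2 1]
  ring

/-! ### Frequency truncation -/

lemma lowPass_of_le {A : ℝ} {ξ : R3} (h : sobWeight ξ ≤ A) : lowPass A ξ = 1 := by
  simp [lowPass, h]

lemma lowPass_of_lt {A : ℝ} {ξ : R3} (h : A < sobWeight ξ) : lowPass A ξ = 0 := by
  simp [lowPass, h]

lemma abs_lowPass_le_one (A : ℝ) (ξ : R3) : |lowPass A ξ| ≤ 1 := by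
  rcases le_or_gt (sobWeight ξ) A with h | h
  · simp [lowPass_of_le h]
  · simp [lowPass_of_lt h]

lemma lowPass_mul_self (A : ℝ) (ξ : R3) : lowPass A ξ * lowPass A ξ = lowPass A ξ := by
  rcases le_or_gt (sobWeight ξ) A with h | h
  · simp [lowPass_of_le h]
  · simp [lowPass_of_lt h]

lemma norm_mulOp_lowPass_le (A : ℝ) (f : CField ι) : ‖mulOp (lowPass A) f‖ ≤ ‖f‖ := by
  simpa using norm_mulOp_apply_le (isSymbol_lowPass A) (abs_lowPass_le_one A) f

lemma tendsto_mulOp_lowPass (f : CField ι) :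
    Tendsto (fun n : ℕ => mulOp (lowPass n) f) atTop (𝓝 f) := by
  rw [Lp.tendsto_Lp_iff_tendsto_eLpNorm']
  have h2 : Tendsto (fun n : ℕ => eLpNorm (⇑(mulOp (lowPass n) f) - ⇑f) 2 volume ^ 2) atTop
      (𝓝 0) := by
    simp only [eLpNorm_two_sq]
    have hlim : (0 : ENNReal) = ∫⁻ _ : R3, 0 := by simp
    rw [hlim]
    refine tendsto_lintegral_of_dominated_convergence' (fun ξ => ‖f ξ‖ₑ ^ 2) (fun n => ?_)
      (fun n => ?_) ?_ ?_
    · exact (((Lp.aestronglyMeasurable _).sub (Lp.aestronglyMeasurable _)).enorm).pow_const 2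
    · filter_upwards [coeFn_mulOp (isSymbol_lowPass n) f] with ξ h
      rw [Pi.sub_apply, h]
      rcases le_or_gt (sobWeight ξ) n with h | h
      · simp [lowPass_of_le h]
      · simp [lowPass_of_lt h]
    · rw [← eLpNorm_two_sq]
      exact (ENNReal.pow_lt_top (Lp.memLp f).2).ne
    · have hall : ∀ᵐ ξ, ∀ n : ℕ, mulOp (lowPass n) f ξ = lowPass n ξ • f ξ :=
        ae_all_iff.2 fun n => coeFn_mulOp (isSymbol_lowPass n) f
      filter_upwards [hall] with ξ h
      refine tendsto_const_nhds.congr' ?_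
      filter_upwards [eventually_ge_atTop ⌈sobWeight ξ⌉₊] with n hn
      have hn' : sobWeight ξ ≤ n := (Nat.le_ceil _).trans (by exact_mod_cast hn)
      simp [h, lowPass_of_le hn']
  have h3 := (ENNReal.continuous_rpow_const (y := (1 / 2 : ℝ))).tendsto 0 |>.comp h2
  rw [ENNReal.zero_rpow_of_pos (by norm_num)] at h3
  refine h3.congr fun n => ?_
  rw [Function.comp_apply, ← ENNReal.rpow_natCast, ← ENNReal.rpow_mul]
  norm_num

/-- The truncated symbol of `-Δ`. -/
def genSymbol (A : ℝ) (ξ : R3) : ℝ := lowPass A ξ * (2 * Real.pi * ‖ξ‖) ^ 2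

/-- The truncated symbol of `e^{tΔ}`, which is bounded for all real `t`. -/
def evolSymbol (A t : ℝ) (ξ : R3) : ℝ := lowPass A ξ * heatSymbol t ξ

lemma freq_sq_le {A : ℝ} {ξ : R3} (h : sobWeight ξ ≤ A) : (2 * Real.pi * ‖ξ‖) ^ 2 ≤ A ^ 2 := by
  have h1 := sobWeight_sq ξ
  have h2 := pow_le_pow_left₀ (sobWeight_pos ξ).le h 2
  linarith

lemma abs_genSymbol_le (A : ℝ) (ξ : R3) : |genSymbol A ξ| ≤ A ^ 2 := by
  unfold genSymbol
  rcases le_or_gt (sobWeight ξ) A with h | h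
  · rw [lowPass_of_le h, one_mul, abs_of_nonneg (by positivity)]
    exact freq_sq_le h
  · rw [lowPass_of_lt h, zero_mul, abs_zero]
    positivity

lemma isSymbol_genSymbol (A : ℝ) : IsSymbol (genSymbol A) :=
  .of_le ((isSymbol_lowPass A).1.mul (by fun_prop)) (abs_genSymbol_le A)

lemma abs_evolSymbol_le (A t : ℝ) (ξ : R3) : |evolSymbol A t ξ| ≤ Real.exp (|t| * A ^ 2) := by
  unfold evolSymbol
  rcases le_or_gt (sobWeight ξ) A with h | h
  · rw [lowPass_of_le h, one_mul, abs_of_pos (heatSymbol_pos t ξ)]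
    refine Real.exp_le_exp.2 ((neg_le_abs _).trans ?_)
    rw [abs_mul, abs_of_nonneg (sq_nonneg (2 * Real.pi * ‖ξ‖))]
    exact mul_le_mul_of_nonneg_left (freq_sq_le h) (abs_nonneg _)
  · rw [lowPass_of_lt h, zero_mul, abs_zero]
    positivity

lemma isSymbol_evolSymbol (A t : ℝ) : IsSymbol (evolSymbol A t) :=
  .of_le ((isSymbol_lowPass A).1.mul (continuous_heatSymbol t).measurable) (abs_evolSymbol_le A t)

lemma evolSymbol_mul (A s t : ℝ) (ξ : R3) :
    evolSymbol A s ξ * evolSymbol A t ξ = evolSymbol A (s + t) ξ := by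
  have h : heatSymbol (s + t) ξ = heatSymbol s ξ * heatSymbol t ξ := by
    rw [heatSymbol, heatSymbol, heatSymbol, ← Real.exp_add]
    ring_nf
  rw [evolSymbol, evolSymbol, evolSymbol, h]
  linear_combination (heatSymbol s ξ * heatSymbol t ξ) * lowPass_mul_self A ξ

lemma mulOp_evolSymbol_mulOp (A s t : ℝ) (f : CField ι) :
    mulOp (evolSymbol A s) (mulOp (evolSymbol A t) f) = mulOp (evolSymbol A (s + t)) f := by
  rw [mulOp_mulOp (isSymbol_evolSymbol A s) (isSymbol_evolSymbol A t)]
  simp only [evolSymbol_mul]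

lemma evolSymbol_zero (A : ℝ) : evolSymbol A 0 = lowPass A := by
  funext ξ
  simp [evolSymbol, heatSymbol]

lemma mulOp_lowPass_heat (A : ℝ) {t : ℝ} (ht : 0 ≤ t) (f : CField ι) :
    mulOp (lowPass A) (mulOp (heatSymbol t) f) = mulOp (evolSymbol A t) f :=
  mulOp_mulOp (isSymbol_lowPass A) (isSymbol_heatSymbol ht) f

lemma hasDerivAt_mulOp_evolSymbol (A t : ℝ) :
    HasDerivAt (fun t => (mulOp (evolSymbol A t) : CField ι →L[ℝ] CField ι))
      (-((mulOp (genSymbol A)).comp (mulOp (evolSymbol A t)))) t := by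
  rw [hasDerivAt_iff_isLittleO_nhds_zero]
  have hO : (fun h : ℝ => (mulOp (evolSymbol A (t + h)) : CField ι →L[ℝ] CField ι) -
      mulOp (evolSymbol A t) - h • -((mulOp (genSymbol A)).comp (mulOp (evolSymbol A t))))
        =O[𝓝 0] fun h => h ^ 2 := by
    refine Asymptotics.IsBigO.of_bound (Real.exp (|t| * A ^ 2) * (A ^ 2) ^ 2) ?_
    have hev : ∀ᶠ h : ℝ in 𝓝 0, |h| * A ^ 2 ≤ 1 := by
      have hc : Continuous fun h : ℝ => |h| * A ^ 2 := by fun_prop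
      exact (hc.tendsto 0).eventually_le_const (by simp)
    filter_upwards [hev] with h hh
    rw [Real.norm_eq_abs, abs_of_nonneg (sq_nonneg h)]
    refine ContinuousLinearMap.opNorm_le_bound _ (by positivity) fun f => ?_
    refine Lp.norm_le_mul_norm_of_ae_le_mul ?_
    simp only [_root_.sub_apply, _root_.smul_apply, _root_.neg_apply,
      ContinuousLinearMap.comp_apply]
    filter_upwards [Lp.coeFn_sub (mulOp (evolSymbol A (t + h)) f - mulOp (evolSymbol A t) f)
        (h • -(mulOp (genSymbol A) (mulOp (evolSymbol A t) f))),
      Lp.coeFn_sub (mulOp (evolSymbol A (t + h)) f) (mulOp (evolSymbol A t) f),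
      Lp.coeFn_smul h (-(mulOp (genSymbol A) (mulOp (evolSymbol A t) f))),
      Lp.coeFn_neg (mulOp (genSymbol A) (mulOp (evolSymbol A t) f)),
      coeFn_mulOp (isSymbol_genSymbol A) (mulOp (evolSymbol A t) f),
      coeFn_mulOp (isSymbol_evolSymbol A t) f, coeFn_mulOp (isSymbol_evolSymbol A (t + h)) f]
      with ξ h1 h2 h3 h4 h5 h6 h7
    rw [h1, Pi.sub_apply, h2, Pi.sub_apply, h3, Pi.smul_apply, h4, Pi.neg_apply, h5, h6, h7,
      smul_smul, smul_neg, smul_smul, sub_neg_eq_add, ← sub_smul, ← add_smul, norm_smul]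
    refine mul_le_mul_of_nonneg_right ?_ (norm_nonneg _)
    rw [Real.norm_eq_abs]
    set l := (2 * Real.pi * ‖ξ‖) ^ 2 with hl
    have hl0 : 0 ≤ l := by positivity
    have hsplit : evolSymbol A (t + h) ξ - evolSymbol A t ξ +
        h * (genSymbol A ξ * evolSymbol A t ξ) =
        evolSymbol A t ξ * (lowPass A ξ * (Real.exp (-(h * l)) - 1 - -(h * l))) := by
      have h8 : lowPass A ξ * evolSymbol A t ξ = evolSymbol A t ξ := by
        rw [evolSymbol, ← mul_assoc, lowPass_mul_self]
      have h9 : evolSymbol A (t + h) ξ = evolSymbol A t ξ * Real.exp (-(h * l)) := by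
        have h10 : evolSymbol A h ξ = lowPass A ξ * Real.exp (-(h * l)) := rfl
        rw [← evolSymbol_mul, h10, ← mul_assoc, mul_comm _ (lowPass A ξ), h8]
      have h11 : genSymbol A ξ = lowPass A ξ * l := rfl
      rw [h9, h11]
      linear_combination (-(Real.exp (-(h * l)) - 1)) * h8
    rw [hsplit, abs_mul, mul_assoc]
    refine mul_le_mul (abs_evolSymbol_le A t ξ) ?_ (abs_nonneg _) (by positivity)
    rcases le_or_gt (sobWeight ξ) A with hA | hA
    · rw [lowPass_of_le hA, one_mul]
      have hlA := freq_sq_le hA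
      have hx : |(-(h * l))| ≤ 1 := by
        rw [abs_neg, abs_mul, abs_of_nonneg hl0]
        exact (mul_le_mul_of_nonneg_left hlA (abs_nonneg h)).trans hh
      refine (Real.abs_exp_sub_one_sub_id_le hx).trans ?_
      have : l ^ 2 ≤ (A ^ 2) ^ 2 := pow_le_pow_left₀ hl0 hlA 2
      nlinarith [sq_nonneg h]
    · rw [lowPass_of_lt hA, zero_mul, abs_zero]
      positivity
  refine hO.trans_isLittleO ?_
  simpa using Asymptotics.isLittleO_pow_pow (𝕜 := ℝ) one_lt_two

lemma continuous_mulOp_evolSymbol (A : ℝ) :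
    Continuous fun t => (mulOp (evolSymbol A t) : CField ι →L[ℝ] CField ι) :=
  continuous_iff_continuousAt.2 fun t => (hasDerivAt_mulOp_evolSymbol A t).continuousAt

/-! ### Duhamel's formula on the frequency side -/

/-- The curve `X` satisfies Duhamel's formula on `[0, b]` with forcing `-(2/3) G`. -/
def IsDuhamel (b : ℝ) (X G : ℝ → CField ι) : Prop :=
  ∀ t ∈ Set.Icc 0 b, X t = mulOp (heatSymbol t) (X 0) -
    (2 / 3 : ℝ) • ∫ τ in (0 : ℝ)..t, mulOp (heatSymbol τ) (G (t - τ))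

/-- The integrand of Duhamel's formula is measurable as the limit of its low frequencies. -/
lemma intervalIntegrable_heat {G : ℝ → CField ι} (hG : Continuous G) {t : ℝ} (ht : 0 ≤ t) :
    IntervalIntegrable (fun τ => mulOp (heatSymbol τ) (G (t - τ))) volume 0 t := by
  rw [intervalIntegrable_iff_integrableOn_Ioc_of_le ht]
  have hG' : Continuous fun τ => G (t - τ) := by fun_prop
  have hb : IntegrableOn (fun τ => ‖G (t - τ)‖) (Set.Ioc 0 t) volume :=
    hG'.norm.integrableOn_Ioc
  refine Integrable.mono' hb ?_ ?_
  · refine aestronglyMeasurable_of_tendsto_ae atTop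
      (f := fun (n : ℕ) τ => mulOp (evolSymbol n τ) (G (t - τ))) (fun n => ?_) ?_
    · exact ((continuous_mulOp_evolSymbol n).clm_apply hG').aestronglyMeasurable
    · filter_upwards [ae_restrict_mem measurableSet_Ioc] with τ hτ
      simp only [← mulOp_lowPass_heat _ hτ.1.le]
      exact tendsto_mulOp_lowPass _
  · filter_upwards [ae_restrict_mem measurableSet_Ioc] with τ hτ
    have h1 : ∀ ξ, |heatSymbol τ ξ| ≤ 1 := fun ξ => by
      rw [abs_of_pos (heatSymbol_pos τ ξ)]
      exact heatSymbol_le_one hτ.1.le ξ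
    simpa using norm_mulOp_apply_le (isSymbol_heatSymbol hτ.1.le) h1 (G (t - τ))

/-- The low frequencies of a curve given by Duhamel's formula, written as
`e^{tΔ} (X0 - (2/3) ∫_0^t e^{-sΔ} G(s) ds)`, which makes sense because the truncated heat semigroup
is a group; in this form differentiability in `t` is plain. -/
def truncSol (A : ℝ) (X0 : CField ι) (G : ℝ → CField ι) (t : ℝ) : CField ι :=
  mulOp (evolSymbol A t) (X0 - (2 / 3 : ℝ) • ∫ s in (0 : ℝ)..t, mulOp (evolSymbol A (-s)) (G s))

lemma truncSol_eq {b A : ℝ} {X G : ℝ → CField ι} (hG : Continuous G) (hX : IsDuhamel b X G)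
    {t : ℝ} (ht : t ∈ Set.Icc 0 b) : truncSol A (X 0) G t = mulOp (lowPass A) (X t) := by
  have hcont : Continuous fun s => mulOp (evolSymbol A (-s)) (G s) :=
    ((continuous_mulOp_evolSymbol A).comp continuous_neg).clm_apply hG
  rw [hX t ht, map_sub, map_smul, mulOp_lowPass_heat A ht.1, truncSol, map_sub, map_smul,
    ← ContinuousLinearMap.intervalIntegral_comp_comm _ (hcont.intervalIntegrable _ _),
    ← ContinuousLinearMap.intervalIntegral_comp_comm _ (intervalIntegrable_heat hG ht.1)]
  congr 2
  have h1 : ∫ τ in (0 : ℝ)..t, mulOp (lowPass A) (mulOp (heatSymbol τ) (G (t - τ))) =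
      ∫ τ in (0 : ℝ)..t, mulOp (evolSymbol A (t - (t - τ))) (G (t - τ)) := by
    refine intervalIntegral.integral_congr fun τ hτ => ?_
    rw [Set.uIcc_of_le ht.1] at hτ
    simp only [sub_sub_cancel]
    exact mulOp_lowPass_heat A hτ.1 _
  rw [h1, intervalIntegral.integral_comp_sub_left (fun s => mulOp (evolSymbol A (t - s)) (G s)) t,
    sub_self, sub_zero]
  refine intervalIntegral.integral_congr fun s _ => ?_
  simp only [mulOp_evolSymbol_mulOp, sub_eq_add_neg]

/-- The low frequencies solve the truncated equation in the classical sense. -/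
lemma hasDerivAt_truncSol (A : ℝ) (X0 : CField ι) {G : ℝ → CField ι} (hG : Continuous G) (t : ℝ) :
    HasDerivAt (truncSol A X0 G) (-mulOp (genSymbol A) (truncSol A X0 G t) -
      (2 / 3 : ℝ) • mulOp (lowPass A) (G t)) t := by
  have hcont : Continuous fun s => mulOp (evolSymbol A (-s)) (G s) :=
    ((continuous_mulOp_evolSymbol A).comp continuous_neg).clm_apply hG
  have h1 := (((hcont.integral_hasStrictDerivAt 0 t).hasDerivAt).const_smul
    (2 / 3 : ℝ)).const_sub X0
  have h2 := (hasDerivAt_mulOp_evolSymbol (ι := ι) A t).clm_apply h1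
  refine h2.congr_deriv ?_
  rw [map_neg, map_smul, mulOp_evolSymbol_mulOp, add_neg_cancel, evolSymbol_zero, ← sub_eq_add_neg]
  rfl

/-! ### The real inner product on the frequency side -/

lemma hasDerivAt_re_inner {f g : ℝ → CField ι} {f' g' : CField ι} {t : ℝ}
    (hf : HasDerivAt f f' t) (hg : HasDerivAt g g' t) :
    HasDerivAt (fun t => (inner ℂ (f t) (g t)).re)
      ((inner ℂ (f t) g').re + (inner ℂ f' (g t)).re) t :=
  Complex.reCLM.hasFDerivAt.comp_hasDerivAt t (hf.inner ℂ hg)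

lemma re_inner_comm (x y : CField ι) : (inner ℂ x y).re = (inner ℂ y x).re :=
  inner_re_symm (𝕜 := ℂ) x y

lemma re_inner_self (x : CField ι) : (inner ℂ x x).re = ‖x‖ ^ 2 :=
  inner_self_eq_norm_sq (𝕜 := ℂ) x

lemma re_inner_smul_left (r : ℝ) (x y : CField ι) :
    (inner ℂ (r • x) y).re = r * (inner ℂ x y).re := by
  rw [← complex_smul_eq_real_smul, inner_smul_left]
  simp

lemma abs_re_inner_le (x y : CField ι) : |(inner ℂ x y).re| ≤ ‖x‖ * ‖y‖ :=
  (Complex.abs_re_le_norm _).trans (norm_inner_le_norm x y)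

lemma continuous_re_inner : Continuous fun p : CField ι × CField ι => (inner ℂ p.1 p.2).re :=
  Complex.continuous_re.comp continuous_inner

lemma two_re_inner_sub_le (v x : CField ι) :
    2 * (inner ℂ v x).re - ‖v‖ ^ 2 ≤ ‖x‖ ^ 2 := by
  have h := norm_sub_sq (𝕜 := ℂ) v x
  have h1 := sq_nonneg ‖v - x‖
  simp only [RCLike.re_eq_complex_re] at h
  linarith

/-! ### The truncated dissipation -/

/-- The truncated dissipation of `X` is the squared norm of the low frequencies of
`(2π|ξ|) X`. -/
lemma re_inner_genSymbol {A : ℝ} {X W : CField ι}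
    (hW : W =ᵐ[volume] fun ξ => (2 * Real.pi * ‖ξ‖) • X ξ) :
    (inner ℂ (mulOp (genSymbol A) (mulOp (lowPass A) X)) (mulOp (lowPass A) X)).re =
      ‖mulOp (lowPass A) W‖ ^ 2 := by
  have hm : IsSymbol fun ξ => lowPass A ξ * (2 * Real.pi * ‖ξ‖) := by
    refine .of_le (C := |A|) ((isSymbol_lowPass A).1.mul (by fun_prop)) fun ξ => ?_
    rcases le_or_gt (sobWeight ξ) A with h | h
    · rw [lowPass_of_le h, one_mul]
      exact sq_le_sq.1 (freq_sq_le h)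
    · rw [lowPass_of_lt h, zero_mul, abs_zero]
      positivity
  have h1 : mulOp (fun ξ => lowPass A ξ * (2 * Real.pi * ‖ξ‖)) X = mulOp (lowPass A) W := by
    refine mulOp_eq_of_ae hm ?_
    filter_upwards [coeFn_mulOp (isSymbol_lowPass A) W, hW] with ξ h1 h2
    rw [h1, h2, smul_smul]
  have h2 : mulOp (fun ξ => lowPass A ξ * (2 * Real.pi * ‖ξ‖)) (mulOp (lowPass A) X) =
      mulOp (lowPass A) W := by
    rw [mulOp_mulOp hm (isSymbol_lowPass A), ← h1]
    congr 2
    funext ξ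
    linear_combination (2 * Real.pi * ‖ξ‖) * lowPass_mul_self A ξ
  have h3 : mulOp (genSymbol A) (mulOp (lowPass A) X) =
      mulOp (fun ξ => lowPass A ξ * (2 * Real.pi * ‖ξ‖)) (mulOp (lowPass A) W) := by
    rw [← h2, mulOp_mulOp hm hm]
    congr 2
    funext ξ
    rw [genSymbol]
    linear_combination (-(2 * Real.pi * ‖ξ‖) ^ 2) * lowPass_mul_self A ξ
  rw [h3, inner_mulOp_left hm, h2, re_inner_self]

lemma tendsto_re_inner {f g : ℕ → CField ι} {x y : CField ι} (hf : Tendsto f atTop (𝓝 x))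
    (hg : Tendsto g atTop (𝓝 y)) :
    Tendsto (fun n => (inner ℂ (f n) (g n)).re) atTop (𝓝 (inner ℂ x y).re) :=
  (Complex.continuous_re.tendsto _).comp (hf.inner hg)

lemma tendsto_re_inner_lowPass (f g : CField ι) :
    Tendsto (fun n : ℕ => (inner ℂ (mulOp (lowPass n) f) (mulOp (lowPass n) g)).re) atTop
      (𝓝 (inner ℂ f g).re) :=
  tendsto_re_inner (tendsto_mulOp_lowPass f) (tendsto_mulOp_lowPass g)

lemma tendsto_norm_sq_lowPass (f : CField ι) :
    Tendsto (fun n : ℕ => ‖mulOp (lowPass n) f‖ ^ 2) atTop (𝓝 (‖f‖ ^ 2)) :=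
  (tendsto_mulOp_lowPass f).norm.pow 2

lemma tendsto_lowPass_quadratic (a c : ℝ) (w f g : CField ι) :
    Tendsto (fun n : ℕ => a * ‖mulOp (lowPass n) w‖ ^ 2 -
        c * (inner ℂ (mulOp (lowPass n) f) (mulOp (lowPass n) g)).re) atTop
      (𝓝 (a * ‖w‖ ^ 2 - c * (inner ℂ f g).re)) :=
  ((tendsto_norm_sq_lowPass w).const_mul a).sub ((tendsto_re_inner_lowPass f g).const_mul c)

lemma norm_lowPass_power_le (A : ℝ) (w f g : CField ι) :
    ‖-2 * ‖mulOp (lowPass A) w‖ ^ 2 -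
        4 / 3 * (inner ℂ (mulOp (lowPass A) f) (mulOp (lowPass A) g)).re‖ ≤
      2 * ‖w‖ ^ 2 + 4 / 3 * (‖f‖ * ‖g‖) := by
  have h1 := norm_mulOp_lowPass_le A w
  have h4 := abs_re_inner_le (mulOp (lowPass A) f) (mulOp (lowPass A) g)
  have h5 : ‖mulOp (lowPass A) f‖ * ‖mulOp (lowPass A) g‖ ≤ ‖f‖ * ‖g‖ :=
    mul_le_mul (norm_mulOp_lowPass_le A f) (norm_mulOp_lowPass_le A g) (norm_nonneg _)
      (norm_nonneg _)
  have h6 : ‖mulOp (lowPass A) w‖ ^ 2 ≤ ‖w‖ ^ 2 := pow_le_pow_left₀ (norm_nonneg _) h1 2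
  have h7 := abs_le.1 (h4.trans h5)
  rw [Real.norm_eq_abs, abs_le]
  have := sq_nonneg ‖mulOp (lowPass A) w‖
  constructor <;> linarith [h7.1, h7.2]

/-! ### The energy identity -/

lemma hasDerivAt_re_inner_self {Y : ℝ → CField ι} {a c : CField ι} {s : ℝ}
    (hY : HasDerivAt Y (-a - (2 / 3 : ℝ) • c) s) :
    HasDerivAt (fun s => ‖Y s‖ ^ 2)
      (-2 * (inner ℂ a (Y s)).re - 4 / 3 * (inner ℂ c (Y s)).re) s := by
  have h := hasDerivAt_re_inner hY hY
  simp only [re_inner_self] at h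
  refine h.congr_deriv ?_
  rw [re_inner_comm (Y s), inner_sub_left, inner_neg_left, Complex.sub_re, Complex.neg_re,
    re_inner_smul_left]
  ring

lemma continuous_truncSol (A : ℝ) (X0 : CField ι) {G : ℝ → CField ι} (hG : Continuous G) :
    Continuous (truncSol A X0 G) :=
  continuous_iff_continuousAt.2 fun s => (hasDerivAt_truncSol A X0 hG s).continuousAt

lemma continuous_truncatedPower (A : ℝ) (X0 : CField ι) {G : ℝ → CField ι} (hG : Continuous G) :
    Continuous fun s => -2 * (inner ℂ (mulOp (genSymbol A) (truncSol A X0 G s))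
        (truncSol A X0 G s)).re -
      4 / 3 * (inner ℂ (mulOp (lowPass A) (G s)) (truncSol A X0 G s)).re := by
  have hY := continuous_truncSol A X0 hG
  have h1 := continuous_re_inner.comp (((mulOp (genSymbol A)).continuous.comp hY).prodMk hY)
  have h2 := continuous_re_inner.comp (((mulOp (lowPass A)).continuous.comp hG).prodMk hY)
  exact (h1.const_mul _).sub (h2.const_mul _)

lemma truncated_energy_identity {b : ℝ} {X G W : ℝ → CField ι} (hG : Continuous G)
    (hX : IsDuhamel b X G)
    (hW : ∀ s ∈ Set.Icc 0 b, W s =ᵐ[volume] fun ξ => (2 * Real.pi * ‖ξ‖) • X s ξ)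
    {t : ℝ} (ht : t ∈ Set.Icc 0 b) (A : ℝ) :
    ‖mulOp (lowPass A) (X t)‖ ^ 2 - ‖mulOp (lowPass A) (X 0)‖ ^ 2 =
      ∫ s in (0 : ℝ)..t, (-2 * ‖mulOp (lowPass A) (W s)‖ ^ 2 -
        4 / 3 * (inner ℂ (mulOp (lowPass A) (G s)) (mulOp (lowPass A) (X s))).re) := by
  have h0 : (0 : ℝ) ∈ Set.Icc 0 b := ⟨le_rfl, ht.1.trans ht.2⟩
  have hsub : Set.uIcc 0 t ⊆ Set.Icc 0 b := by
    rw [Set.uIcc_of_le ht.1]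
    exact Set.Icc_subset_Icc_right ht.2
  have hftc := intervalIntegral.integral_eq_sub_of_hasDerivAt (a := 0) (b := t)
    (fun s _ => hasDerivAt_re_inner_self (hasDerivAt_truncSol A (X 0) hG s))
    ((continuous_truncatedPower A (X 0) hG).intervalIntegrable _ _)
  rw [← truncSol_eq hG hX ht, ← truncSol_eq hG hX h0, ← hftc]
  refine intervalIntegral.integral_congr fun s hs => ?_
  beta_reduce
  rw [← re_inner_genSymbol (hW s (hsub hs)), ← truncSol_eq hG hX (hsub hs)]

/-- The energy identity, the limit of its truncated versions by dominated convergence. -/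
lemma energy_identity {b : ℝ} {X G W : ℝ → CField ι} (hG : Continuous G)
    (hX : IsDuhamel b X G) (hXc : ContinuousOn X (Set.Icc 0 b))
    (hW : ∀ s ∈ Set.Icc 0 b, W s =ᵐ[volume] fun ξ => (2 * Real.pi * ‖ξ‖) • X s ξ)
    (hD : ContinuousOn (fun s => ‖W s‖ ^ 2) (Set.Icc 0 b)) {t : ℝ} (ht : t ∈ Set.Icc 0 b) :
    ‖X t‖ ^ 2 - ‖X 0‖ ^ 2 =
      ∫ s in (0 : ℝ)..t, (-2 * ‖W s‖ ^ 2 - 4 / 3 * (inner ℂ (G s) (X s)).re) := by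
  have hsub : Set.uIcc 0 t ⊆ Set.Icc 0 b := by
    rw [Set.uIcc_of_le ht.1]
    exact Set.Icc_subset_Icc_right ht.2
  have hn := fun n : ℕ => truncated_energy_identity hG hX hW ht n
  have hlim : Tendsto (fun n : ℕ => ‖mulOp (lowPass n) (X t)‖ ^ 2 - ‖mulOp (lowPass n) (X 0)‖ ^ 2)
      atTop (𝓝 (‖X t‖ ^ 2 - ‖X 0‖ ^ 2)) :=
    (tendsto_norm_sq_lowPass _).sub (tendsto_norm_sq_lowPass _)
  have hint : IntervalIntegrable (fun s => 2 * ‖W s‖ ^ 2 + 4 / 3 * (‖G s‖ * ‖X s‖)) volume 0 t := by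
    refine ContinuousOn.intervalIntegrable ?_
    exact ((hD.mono hsub).const_mul 2).add
      ((hG.norm.continuousOn.mul (hXc.mono hsub).norm).const_mul (4 / 3))
  have hmeas : ∀ n : ℕ, AEStronglyMeasurable (fun s => -2 * ‖mulOp (lowPass n) (W s)‖ ^ 2 -
      4 / 3 * (inner ℂ (mulOp (lowPass n) (G s)) (mulOp (lowPass n) (X s))).re)
      (volume.restrict (Set.uIoc 0 t)) := by
    intro n
    have hcont := continuous_truncatedPower n (X 0) hG
    refine (hcont.aestronglyMeasurable.restrict (s := Set.uIoc 0 t)).congr ?_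
    filter_upwards [ae_restrict_mem measurableSet_uIoc] with s hs
    have hs' := hsub (Set.uIoc_subset_uIcc hs)
    rw [← re_inner_genSymbol (hW s hs'), ← truncSol_eq hG hX hs']
  have hconv := intervalIntegral.tendsto_integral_filter_of_dominated_convergence
    (l := atTop) _ (Eventually.of_forall hmeas)
    (Eventually.of_forall fun n => Eventually.of_forall fun s _ =>
      norm_lowPass_power_le n (W s) (G s) (X s)) hint
    (Eventually.of_forall fun s _ => tendsto_lowPass_quadratic (-2) (4 / 3) (W s) (G s) (X s))
  refine tendsto_nhds_unique hlim (hconv.congr fun n => ?_)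
  exact (hn n).symm

/-! ### The gradient flow inequality -/

/-- The rate `-6 ⟨a, y⟩ - 4 ⟨c, y⟩ = 6 ‖y‖² + 4 ⟨e - c, y⟩` of a gradient flow `y = -a - (2/3) e`
is bounded below, up to the error `e - c` of the forcing, by linear functions of `y`. -/
lemma gradient_rate_lower_bound {a c e y v : CField ι} (hy : y = -a - (2 / 3 : ℝ) • e) {ε : ℝ}
    (hε : ε ≤ 3) (hce : ‖e - c‖ ≤ ε) :
    (6 - 2 * ε) * (2 * (inner ℂ v y).re - ‖v‖ ^ 2) - 2 * ε ≤
      -3 * (2 * (inner ℂ a y).re) - 4 * (inner ℂ c y).re := by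
  have hε0 : 0 ≤ ε := (norm_nonneg _).trans hce
  have ha : a = -y - (2 / 3 : ℝ) • e := by
    rw [hy, neg_sub', neg_neg, sub_neg_eq_add, add_sub_cancel_right]
  have h1 : (inner ℂ a y).re = -‖y‖ ^ 2 - 2 / 3 * (inner ℂ e y).re := by
    rw [ha, inner_sub_left, inner_neg_left, Complex.sub_re, Complex.neg_re, re_inner_smul_left,
      re_inner_self]
  have h0 : (inner ℂ (e - c) y).re = (inner ℂ e y).re - (inner ℂ c y).re := by
    rw [inner_sub_left, Complex.sub_re]
  have h2 := abs_re_inner_le (e - c) y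
  have h4 : ‖e - c‖ * ‖y‖ ≤ ε * ‖y‖ := mul_le_mul_of_nonneg_right hce (norm_nonneg _)
  have h5 := (abs_le.1 (h2.trans h4)).1
  have h6 := two_re_inner_sub_le v y
  have h7 := mul_le_mul_of_nonneg_left h6 (show 0 ≤ 6 - 2 * ε by linarith)
  have h8 : 2 * (ε * ‖y‖) ≤ ε * (1 + ‖y‖ ^ 2) := by
    have := mul_nonneg hε0 (sq_nonneg (‖y‖ - 1))
    linarith
  rw [h1]
  linarith

/-- The rate bound for the truncated flow, integrated in time from `t` to `r`. -/
lemma truncated_gradient_inequality (A : ℝ) (X0 : CField ι) {G : ℝ → CField ι} (hG : Continuous G)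
    {t r ε : ℝ} (htr : t ≤ r) (hε : ε ≤ 3) (hGε : ∀ s ∈ Set.Icc t r, ‖G s - G t‖ ≤ ε)
    (v : CField ι) {Y : ℝ → CField ι} (hY : Y = truncSol A X0 G) :
    (6 - 2 * ε) * (2 * (inner ℂ v (Y r - Y t)).re - ‖v‖ ^ 2 * (r - t)) - 2 * ε * (r - t) ≤
      (-3 * (inner ℂ (mulOp (genSymbol A) (Y r)) (Y r)).re -
        4 * (inner ℂ (mulOp (lowPass A) (G t)) (Y r)).re) -
      (-3 * (inner ℂ (mulOp (genSymbol A) (Y t)) (Y t)).re -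
        4 * (inner ℂ (mulOp (lowPass A) (G t)) (Y t)).re) := by
  obtain ⟨Y', hY'⟩ : ∃ Y' : ℝ → CField ι, ∀ s, Y' s = -mulOp (genSymbol A) (Y s) -
      (2 / 3 : ℝ) • mulOp (lowPass A) (G s) := ⟨_, fun s => rfl⟩
  have hYd : ∀ s, HasDerivAt Y (Y' s) s := fun s => by
    rw [hY' s, hY]
    exact hasDerivAt_truncSol A X0 hG s
  have hψd : ∀ s, HasDerivAt (fun s => (-3 * (inner ℂ (mulOp (genSymbol A) (Y s)) (Y s)).re -
      4 * (inner ℂ (mulOp (lowPass A) (G t)) (Y s)).re) -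
      ((6 - 2 * ε) * (2 * (inner ℂ v (Y s)).re - ‖v‖ ^ 2 * s) - 2 * ε * s))
      ((-3 * (2 * (inner ℂ (mulOp (genSymbol A) (Y s)) (Y' s)).re) -
      4 * (inner ℂ (mulOp (lowPass A) (G t)) (Y' s)).re) -
      ((6 - 2 * ε) * (2 * (inner ℂ v (Y' s)).re - ‖v‖ ^ 2) - 2 * ε)) s := by
    intro s
    have h1 := hasDerivAt_re_inner
      ((mulOp (ι := ι) (genSymbol A)).hasFDerivAt.comp_hasDerivAt s (hYd s)) (hYd s)
    have h2 := hasDerivAt_re_inner (hasDerivAt_const s (mulOp (lowPass A) (G t))) (hYd s)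
    have h3 := hasDerivAt_re_inner (hasDerivAt_const s v) (hYd s)
    have h4 := ((h1.const_mul (-3)).sub (h2.const_mul 4)).sub
      ((((h3.const_mul 2).sub ((hasDerivAt_id s).const_mul (‖v‖ ^ 2))).const_mul (6 - 2 * ε)).sub
        ((hasDerivAt_id s).const_mul (2 * ε)))
    refine h4.congr_deriv ?_
    rw [inner_mulOp_left (isSymbol_genSymbol A) (Y' s), re_inner_comm (Y' s)]
    simp only [inner_zero_left, Complex.zero_re, Function.comp_apply]
    ring
  have hmono := monotoneOn_of_deriv_nonneg (convex_Icc t r)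
    (fun s _ => (hψd s).continuousAt.continuousWithinAt)
    (fun s _ => (hψd s).differentiableAt.differentiableWithinAt) (fun s hs => by
      rw [interior_Icc] at hs
      rw [(hψd s).deriv]
      refine sub_nonneg.2 (gradient_rate_lower_bound (hY' s) hε ?_)
      rw [← map_sub]
      exact (norm_mulOp_lowPass_le _ _).trans (hGε s ⟨hs.1.le, hs.2.le⟩))
  have hle := hmono ⟨le_rfl, htr⟩ ⟨htr, le_rfl⟩ htr
  rw [inner_sub_right, Complex.sub_re]
  simp only at hle
  linarith

/-- The equation is the gradient flow of `v ↦ (3 ‖∇v‖² + 4 ⟨g, v⟩) / 6` up to the variation of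
the forcing, so that this functional decreases at the rate `‖∂ₜX‖²`, which is bounded below
by `2 ⟨v, ∂ₜX⟩ - ‖v‖²` for every fixed `v`. -/
lemma gradient_inequality {b : ℝ} {X G W : ℝ → CField ι} (hG : Continuous G)
    (hX : IsDuhamel b X G)
    (hW : ∀ s ∈ Set.Icc 0 b, W s =ᵐ[volume] fun ξ => (2 * Real.pi * ‖ξ‖) • X s ξ)
    {t r ε : ℝ} (ht : 0 ≤ t) (htr : t ≤ r) (hr : r ≤ b) (hε : ε ≤ 3)
    (hGε : ∀ s ∈ Set.Icc t r, ‖G s - G t‖ ≤ ε) (v : CField ι) :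
    (6 - 2 * ε) * (2 * (inner ℂ v (X r - X t)).re - ‖v‖ ^ 2 * (r - t)) - 2 * ε * (r - t) ≤
      (-3 * ‖W r‖ ^ 2 - 4 * (inner ℂ (G t) (X r)).re) -
        (-3 * ‖W t‖ ^ 2 - 4 * (inner ℂ (G t) (X t)).re) := by
  have htm : t ∈ Set.Icc 0 b := ⟨ht, htr.trans hr⟩
  have hrm : r ∈ Set.Icc 0 b := ⟨ht.trans htr, hr⟩
  have hn := fun n : ℕ => truncated_gradient_inequality n (X 0) hG htr hε hGε v rfl
  simp only [truncSol_eq hG hX hrm, truncSol_eq hG hX htm, re_inner_genSymbol (hW r hrm),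
    re_inner_genSymbol (hW t htm)] at hn
  have hl : Tendsto (fun n : ℕ =>
      (inner ℂ v (mulOp (lowPass n) (X r) - mulOp (lowPass n) (X t))).re) atTop
      (𝓝 (inner ℂ v (X r - X t)).re) :=
    tendsto_re_inner tendsto_const_nhds ((tendsto_mulOp_lowPass _).sub (tendsto_mulOp_lowPass _))
  exact le_of_tendsto_of_tendsto'
    ((((hl.const_mul 2).sub_const (‖v‖ ^ 2 * (r - t))).const_mul (6 - 2 * ε)).sub_const
      (2 * ε * (r - t)))
    ((tendsto_lowPass_quadratic (-3) 4 (W r) (G t) (X r)).sub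
      (tendsto_lowPass_quadratic (-3) 4 (W t) (G t) (X t))) hn

/-! ### The time interval -/

lemma exists_gt_mem_timeInterval {T : EReal} {t : ℝ} (ht : t ∈ timeInterval T) :
    ∃ b ∈ timeInterval T, t < b := by
  obtain ⟨b, hb1, hb2⟩ := EReal.lt_iff_exists_real_btwn.1 ht.2
  have hb : t < b := EReal.coe_lt_coe_iff.1 hb1
  exact ⟨b, ⟨ht.1.trans hb.le, hb2⟩, hb⟩

lemma Icc_subset_timeInterval {T : EReal} {b : ℝ} (hb : b ∈ timeInterval T) :
    Set.Icc 0 b ⊆ timeInterval T := fun _ hs =>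
  ⟨hs.1, (EReal.coe_le_coe_iff.2 hs.2).trans_lt hb.2⟩

lemma ordConnected_timeInterval (T : EReal) : (timeInterval T).OrdConnected :=
  ⟨fun _ hx _ hy _ hz => Icc_subset_timeInterval hy ⟨hx.1.trans hz.1, hz.2⟩⟩

lemma timeInterval_mem_nhdsGE {T : EReal} {t : ℝ} (ht : t ∈ timeInterval T) :
    timeInterval T ∈ 𝓝[≥] t := by
  obtain ⟨b, hb, htb⟩ := exists_gt_mem_timeInterval ht
  filter_upwards [Icc_mem_nhdsGE htb] with s hs
  exact Icc_subset_timeInterval hb ⟨ht.1.trans hs.1, hs.2⟩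

lemma nhdsGE_le_nhdsWithin_timeInterval {T : EReal} {t : ℝ} (ht : t ∈ timeInterval T) :
    𝓝[≥] t ≤ 𝓝[timeInterval T] t :=
  nhdsWithin_le_iff.2 (timeInterval_mem_nhdsGE ht)

/-! ### Continuity in time -/

lemma sobolevNorm_neg (f : L2Field ι) :
    sobolevNorm 1 (-f) = sobolevNorm 1 f := by
  have h : fourierL2 (-f) = -fourierL2 f := (fourierIsometry ι).map_neg f
  rw [sobolevNorm_one_eq, sobolevNorm_one_eq, h]
  refine eLpNorm_congr_norm_ae ?_
  filter_upwards [Lp.coeFn_neg (fourierL2 f)] with ξ h1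
  rw [h1, Pi.neg_apply, smul_neg, norm_neg]

lemma h1Norm_sub_comm (f g : L2Field ι) :
    h1Norm (f - g) = h1Norm (g - f) := by
  rw [h1Norm, h1Norm, ← sobolevNorm_neg, neg_sub]

lemma finite_of_continuousInH1st {T : EReal} {S : ℝ → MatrixField} (hS : ContinuousInH1st T S)
    {t : ℝ} (ht : t ∈ timeInterval T) : sobolevNorm 1 (S t) < ⊤ :=
  sobolevNorm_lt_top_of_mem_Hst (hS.1 t ht)

lemma sub_finite_of_continuousInH1st {T : EReal} {S : ℝ → MatrixField}
    (hS : ContinuousInH1st T S) {r t : ℝ} (hr : r ∈ timeInterval T) (ht : t ∈ timeInterval T) :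
    sobolevNorm 1 (S r - S t) < ⊤ :=
  sobolevNorm_lt_top_of_mem_Hst (sub_mem (hS.1 r hr) (hS.1 t ht))

lemma tendsto_h1Norm_sub {T : EReal} {S : ℝ → MatrixField} (hS : ContinuousInH1st T S) {t : ℝ}
    (ht : t ∈ timeInterval T) :
    Tendsto (fun r => h1Norm (S r - S t)) (𝓝[timeInterval T] t) (𝓝 0) :=
  (ENNReal.tendsto_toReal ENNReal.zero_ne_top).comp (hS.2 t ht)

/-- A function of time whose increments are bounded by a modulus `ω t` of the `H¹` distance is
continuous. -/
lemma continuousOn_of_norm_sub_le {E : Type*} [NormedAddCommGroup E] {T : EReal}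
    {S : ℝ → MatrixField} (hS : ContinuousInH1st T S) {Φ : ℝ → E} (ω : ℝ → ℝ → ℝ)
    (hω : ∀ t, Continuous (ω t)) (hω0 : ∀ t, ω t 0 = 0)
    (hΦ : ∀ t ∈ timeInterval T, ∀ r ∈ timeInterval T,
      ‖Φ r - Φ t‖ ≤ ω t (h1Norm (S r - S t))) : ContinuousOn Φ (timeInterval T) := by
  intro t ht
  refine tendsto_iff_norm_sub_tendsto_zero.2 ?_
  have h1 : Tendsto (fun r => ω t (h1Norm (S r - S t))) (𝓝[timeInterval T] t) (𝓝 0) := by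
    simpa only [hω0, Function.comp_def] using ((hω t).tendsto 0).comp (tendsto_h1Norm_sub hS ht)
  refine squeeze_zero' (Eventually.of_forall fun r => norm_nonneg _) ?_ h1
  filter_upwards [self_mem_nhdsWithin] with r hr using hΦ t ht r hr

lemma continuousOn_of_continuousInH1st {T : EReal} {S : ℝ → MatrixField}
    (hS : ContinuousInH1st T S) : ContinuousOn S (timeInterval T) :=
  continuousOn_of_norm_sub_le hS (fun _ x => x) (fun _ => continuous_id) (fun _ => rfl)
    fun _ ht _ hr => norm_le_h1Norm _ (sub_finite_of_continuousInH1st hS hr ht)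

lemma continuousOn_homSobolevNorm {T : EReal} {S : ℝ → MatrixField}
    (hS : ContinuousInH1st T S) :
    ContinuousOn (fun t => homSobolevNorm 1 (S t)) (timeInterval T) := by
  refine continuousOn_of_norm_sub_le hS (fun _ x => x) (fun _ => continuous_id) (fun _ => rfl)
    fun t ht r hr => ?_
  have h1 := homSobolevNorm_le_add (S t) (S r) (finite_of_continuousInH1st hS ht)
    (sub_finite_of_continuousInH1st hS hr ht)
  have h2 := homSobolevNorm_le_add (S r) (S t) (finite_of_continuousInH1st hS hr)
    (sub_finite_of_continuousInH1st hS ht hr)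
  rw [h1Norm_sub_comm] at h2
  rw [Real.norm_eq_abs, abs_sub_le_iff]
  constructor <;> linarith

lemma continuousOn_sqL2 {T : EReal} {S : ℝ → MatrixField} (hS : ContinuousInH1st T S) :
    ContinuousOn (fun t => sqL2 (S t)) (timeInterval T) := by
  refine continuousOn_of_norm_sub_le hS
    (fun t x => sobolevConst ^ 2 * ((2 * h1Norm (S t) + x) * x))
    (fun t => by fun_prop) (fun t => by simp) fun t ht r hr => ?_
  have h1 := h1Norm_le_add (S t) (S r) (finite_of_continuousInH1st hS ht)
    (sub_finite_of_continuousInH1st hS hr ht)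
  refine (norm_sqL2_sub_le (S r) (S t) (finite_of_continuousInH1st hS hr)
    (finite_of_continuousInH1st hS ht) (sub_finite_of_continuousInH1st hS hr ht)).trans ?_
  refine mul_le_mul_of_nonneg_left (mul_le_mul_of_nonneg_right ?_ (h1Norm_nonneg _)) (sq_nonneg _)
  linarith

lemma tendsto_sqL2_sub {T : EReal} {S : ℝ → MatrixField} (hS : ContinuousInH1st T S) {t : ℝ}
    (ht : t ∈ timeInterval T) :
    Tendsto (fun r => ‖sqL2 (S r - S t)‖) (𝓝[timeInterval T] t) (𝓝 0) := by
  have h1 : Tendsto (fun r => sobolevConst ^ 2 * h1Norm (S r - S t) ^ 2) (𝓝[timeInterval T] t)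
      (𝓝 0) := by
    simpa using ((tendsto_h1Norm_sub hS ht).pow 2).const_mul (sobolevConst ^ 2)
  refine squeeze_zero' (Eventually.of_forall fun r => norm_nonneg _) ?_ h1
  filter_upwards [self_mem_nhdsWithin] with r hr
  exact norm_sqL2_le _ (sub_finite_of_continuousInH1st hS hr ht)

lemma continuousOn_integral_detField {T : EReal} {S : ℝ → MatrixField}
    (hS : ContinuousInH1st T S) :
    ContinuousOn (fun t => ∫ x, detField (S t) x) (timeInterval T) := by
  have h : ContinuousOn (fun t => (1 / 3 : ℝ) * inner ℝ (sqL2 (S t)) (S t)) (timeInterval T) :=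
    ((continuousOn_sqL2 hS).inner (continuousOn_of_continuousInH1st hS)).const_mul _
  exact h.congr fun t ht => integral_detField (hS.1 t ht)

/-- The numerator `-3 ‖S‖²_{Ḣ¹} - 4 ∫ det S` of the growth ratio. -/
def growthNumerator (S : MatrixField) : ℝ :=
  -3 * homSobolevNorm 1 S ^ 2 - 4 * ∫ x : R3, detField S x

lemma continuousOn_growthNumerator {T : EReal} {S : ℝ → MatrixField}
    (hS : ContinuousInH1st T S) :
    ContinuousOn (fun t => growthNumerator (S t)) (timeInterval T) :=
  (((continuousOn_homSobolevNorm hS).pow 2).const_mul _).sub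
    ((continuousOn_integral_detField hS).const_mul _)

/-! ### Mild solutions on the frequency side -/

/-- `P_st` is invisible when tested against strain fields. -/
lemma inner_Pst {f w : MatrixField} (hw : w ∈ Hst 1) : inner ℝ (Pst f) w = inner ℝ f w := by
  have hw' : w ∈ (Hst 0).topologicalClosure := subset_closure (mem_Hst_zero hw)
  rw [Pst, Submodule.inner_starProjection_left_eq_right,
    Submodule.starProjection_eq_self_iff.2 hw']

/-- `W` stands for the Fourier transform of `(-Δ)^{1/2} f`. -/
lemma exists_freq_mul_fourierL2 (f : L2Field ι) (hf : sobolevNorm 1 f < ⊤) :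
    ∃ W : CField ι, W =ᵐ[volume] (fun ξ => (2 * Real.pi * ‖ξ‖) • fourierL2 f ξ) ∧
      ‖W‖ = homSobolevNorm 1 f := by
  have h : MemLp (fun ξ => (2 * Real.pi * ‖ξ‖) • fourierL2 f ξ) 2 (volume : Measure R3) :=
    ⟨aestronglyMeasurable_homWeight f, (eLpNorm_homWeight_le f).trans_lt hf⟩
  exact ⟨h.toLp _, h.coeFn_toLp, by rw [Lp.norm_toLp, homSobolevNorm_one_eq]⟩

lemma mulOp_heatSymbol_zero (f : CField ι) :
    mulOp (heatSymbol 0) f = f := by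
  ext1
  filter_upwards [coeFn_mulOp (isSymbol_heatSymbol le_rfl) f] with ξ h
  simp [h, heatSymbol]

/-- On the frequency side a mild solution satisfies Duhamel's formula on compact time intervals,
with a forcing `G` extended to a continuous function of all times. -/
lemma exists_frequency_curves {T : EReal} {S : ℝ → MatrixField} (hS : IsMildSolution T S) {b : ℝ}
    (hb : b ∈ timeInterval T) :
    ∃ G W : ℝ → CField (Fin 3 × Fin 3), Continuous G ∧ IsDuhamel b (fun t => fourierL2 (S t)) G ∧
      (∀ s ∈ Set.Icc 0 b, G s = fourierL2 (Pst (sqL2 (S s)))) ∧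
      (∀ s ∈ Set.Icc 0 b, W s =ᵐ[volume] fun ξ => (2 * Real.pi * ‖ξ‖) • fourierL2 (S s) ξ) ∧
      ∀ s ∈ Set.Icc 0 b, ‖W s‖ = homSobolevNorm 1 (S s) := by
  have hb0 : 0 ≤ b := hb.1
  have hsub := Icc_subset_timeInterval hb
  have hW : ∀ s, ∃ W : CField (Fin 3 × Fin 3), s ∈ Set.Icc 0 b →
      W =ᵐ[volume] (fun ξ => (2 * Real.pi * ‖ξ‖) • fourierL2 (S s) ξ) ∧
        ‖W‖ = homSobolevNorm 1 (S s) := by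
    intro s
    by_cases hs : s ∈ Set.Icc 0 b
    · obtain ⟨W, hW⟩ := exists_freq_mul_fourierL2 (S s)
        (finite_of_continuousInH1st hS.continuous (hsub hs))
      exact ⟨W, fun _ => hW⟩
    · exact ⟨0, fun h => absurd h hs⟩
  choose W hW using hW
  have hFc : ContinuousOn (fun s => fourierL2 (Pst (sqL2 (S s)))) (Set.Icc 0 b) :=
    (fourierIsometry _).continuous.comp_continuousOn
      (Pst.continuous.comp_continuousOn ((continuousOn_sqL2 hS.continuous).mono hsub))
  have hG : ∀ s ∈ Set.Icc 0 b,
      Set.IccExtend hb0 ((Set.Icc 0 b).domRestrict fun s => fourierL2 (Pst (sqL2 (S s)))) s =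
        fourierL2 (Pst (sqL2 (S s))) := fun s hs => by
    rw [Set.IccExtend_of_mem hb0 _ hs, Set.domRestrict_apply]
  refine ⟨_, W, (continuousOn_iff_continuous_domRestrict.1 hFc).Icc_extend' (h := hb0), ?_, hG,
    fun s hs => (hW s hs).1, fun s hs => (hW s hs).2⟩
  intro t ht
  rcases ht.1.eq_or_lt with rfl | h0
  · simp only [intervalIntegral.integral_same, smul_zero, sub_zero, mulOp_heatSymbol_zero]
  · have hd := hS.duhamel t (hsub ht) h0
    have hint : fourierL2 (∫ τ in (0 : ℝ)..t, heat τ (Pst (sqL2 (S (t - τ))))) =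
        ∫ τ in (0 : ℝ)..t, fourierL2 (heat τ (Pst (sqL2 (S (t - τ))))) := by
      rw [intervalIntegral.integral_of_le ht.1, intervalIntegral.integral_of_le ht.1]
      exact ((fourierIsometry (Fin 3 × Fin 3)).integral_comp_comm _).symm
    have h1 : fourierL2 (S t) = fourierL2 (heat t (S 0)) -
        (2 / 3 : ℝ) • fourierL2 (∫ τ in (0 : ℝ)..t, heat τ (Pst (sqL2 (S (t - τ))))) := by
      conv_lhs => rw [hd]
      rw [fourierL2_sub, fourierL2_smul, complex_smul_eq_real_smul]
    beta_reduce
    rw [h1, fourierL2_heat ht.1, hint]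
    congr 2
    refine intervalIntegral.integral_congr fun τ hτ => ?_
    rw [Set.uIcc_of_le ht.1] at hτ
    beta_reduce
    rw [fourierL2_heat hτ.1, hG (t - τ) ⟨by linarith [hτ.2], by linarith [hτ.1, ht.2]⟩]

/-! ### The enstrophy and the functional `-3 ‖S‖²_{Ḣ¹} - 4 ∫ det S` -/

lemma enstrophy_identity {T : EReal} {S : ℝ → MatrixField} (hS : IsMildSolution T S) {t : ℝ}
    (ht : t ∈ timeInterval T) :
    enstrophy S t - enstrophy S 0 =
      ∫ s in (0 : ℝ)..t, (growthNumerator (S s) + homSobolevNorm 1 (S s) ^ 2) := by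
  obtain ⟨G, W, hG, hX, hGF, hW, hWn⟩ := exists_frequency_curves hS ht
  have hsub := Icc_subset_timeInterval ht
  have hXc : ContinuousOn (fun t => fourierL2 (S t)) (Set.Icc 0 t) :=
    (fourierIsometry _).continuous.comp_continuousOn
      ((continuousOn_of_continuousInH1st hS.continuous).mono hsub)
  have hD : ContinuousOn (fun s => ‖W s‖ ^ 2) (Set.Icc 0 t) :=
    (((continuousOn_homSobolevNorm hS.continuous).mono hsub).pow 2).congr fun s hs => by
      simp only [hWn s hs, Pi.pow_apply]
  have h := energy_identity hG hX hXc hW hD ⟨ht.1, le_rfl⟩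
  simp only [norm_fourierL2] at h
  rw [enstrophy, enstrophy, h]
  refine intervalIntegral.integral_congr fun s hs => ?_
  rw [Set.uIcc_of_le ht.1] at hs
  have hm := hS.continuous.1 s (hsub hs)
  rw [hWn s hs, hGF s hs, re_inner_fourierL2, inner_Pst hm, growthNumerator, integral_detField hm]
  ring

/-- The enstrophy balance `∂ₜE = f + ‖S‖²_{Ḣ¹}`, where `f = -3 ‖S‖²_{Ḣ¹} - 4 ∫ det S`. -/
lemma hasDerivWithinAt_enstrophy {T : EReal} {S : ℝ → MatrixField} (hS : IsMildSolution T S)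
    {t : ℝ} (ht : t ∈ timeInterval T) :
    HasDerivWithinAt (enstrophy S) (growthNumerator (S t) + homSobolevNorm 1 (S t) ^ 2)
      (timeInterval T) t := by
  obtain ⟨b, hb, htb⟩ := exists_gt_mem_timeInterval ht
  have hsub := Icc_subset_timeInterval hb
  have hec : ContinuousOn (fun s => growthNumerator (S s) + homSobolevNorm 1 (S s) ^ 2)
      (Set.Icc 0 b) :=
    ((continuousOn_growthNumerator hS.continuous).add
      ((continuousOn_homSobolevNorm hS.continuous).pow 2)).mono hsub
  have htm : t ∈ Set.Icc 0 b := ⟨ht.1, htb.le⟩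
  have := Fact.mk htm
  have hd : HasDerivWithinAt
      (fun u => ∫ s in (0 : ℝ)..u, (growthNumerator (S s) + homSobolevNorm 1 (S s) ^ 2))
      (growthNumerator (S t) + homSobolevNorm 1 (S t) ^ 2) (Set.Icc 0 b) t := by
    refine intervalIntegral.integral_hasDerivWithinAt_right
      ((hec.mono (Set.uIcc_subset_Icc ⟨le_rfl, hb.1⟩ htm)).intervalIntegrable) ?_ (hec t htm)
    exact hec.stronglyMeasurableAtFilter_nhdsWithin measurableSet_Icc t
  have hd' : HasDerivWithinAt (enstrophy S) (growthNumerator (S t) + homSobolevNorm 1 (S t) ^ 2)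
      (Set.Icc 0 b) t :=
    (hd.const_add (enstrophy S 0)).congr_of_mem
      (fun s hs => by rw [← enstrophy_identity hS (hsub hs)]; ring) htm
  refine hd'.mono_of_mem_nhdsWithin ?_
  have : Set.Iio b ∈ 𝓝[timeInterval T] t := mem_nhdsWithin_of_mem_nhds (Iio_mem_nhds htb)
  filter_upwards [this, self_mem_nhdsWithin] with s hs1 hs2 using ⟨hs2.1, hs1.le⟩

/-- The functional `f = -3 ‖S‖²_{Ḣ¹} - 4 ∫ det S` grows at least at the rate `6 ‖∂ₜS‖²`, up to an
error which is small against the increments of time. -/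
lemma eventually_growthNumerator_sub_ge {T : EReal} {S : ℝ → MatrixField}
    (hS : IsMildSolution T S) {t : ℝ} (ht : t ∈ timeInterval T) {ε : ℝ} (hε : 0 < ε) :
    ∀ᶠ r in 𝓝[>] t, (6 - ε) * (‖S r - S t‖ ^ 2 / (r - t)) - ε * (r - t) ≤
      growthNumerator (S r) - growthNumerator (S t) := by
  obtain ⟨b, hb, htb⟩ := exists_gt_mem_timeInterval ht
  obtain ⟨G, W, hG, hX, hGF, hW, hWn⟩ := exists_frequency_curves hS hb
  have hsub := Icc_subset_timeInterval hb
  obtain ⟨η, hη0, hη3, hηε⟩ : ∃ η > 0, η ≤ 3 ∧ 3 * η ≤ ε :=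
    ⟨min 3 (ε / 3), by positivity, min_le_left _ _, by linarith [min_le_right 3 (ε / 3)]⟩
  have hGc : ∀ᶠ s in 𝓝[≥] t, ‖G s - G t‖ ≤ η := by
    have h := (hG.tendsto t).mono_left (nhdsWithin_le_nhds (s := Set.Ici t))
    exact (tendsto_iff_norm_sub_tendsto_zero.1 h).eventually_le_const hη0
  obtain ⟨u, htu, hu⟩ := mem_nhdsGE_iff_exists_Ico_subset.1 hGc
  have hle : 𝓝[>] t ≤ 𝓝[timeInterval T] t :=
    (nhdsWithin_mono t Set.Ioi_subset_Ici_self).trans (nhdsGE_le_nhdsWithin_timeInterval ht)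
  have hsq : ∀ᶠ r in 𝓝[>] t, 2 * ‖sqL2 (S r) - sqL2 (S t)‖ + ‖sqL2 (S r - S t)‖ ≤ η := by
    have h1 := tendsto_iff_norm_sub_tendsto_zero.1 (continuousOn_sqL2 hS.continuous t ht)
    have h2 := ((h1.const_mul 2).add (tendsto_sqL2_sub hS.continuous ht)).mono_left hle
    rw [mul_zero, add_zero] at h2
    exact h2.eventually_le_const hη0
  filter_upwards [hsq, Ioo_mem_nhdsGT htu, Ioo_mem_nhdsGT htb] with r hr1 hr2 hr3
  have hh : 0 < r - t := sub_pos.2 hr3.1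
  have hrm : r ∈ Set.Icc 0 b := ⟨ht.1.trans hr3.1.le, hr3.2.le⟩
  have htm : t ∈ Set.Icc 0 b := ⟨ht.1, htb.le⟩
  have hSr := hS.continuous.1 r (hsub hrm)
  have hSt := hS.continuous.1 t ht
  -- the optimal test vector is the difference quotient of the solution
  have hgi := gradient_inequality hG hX hW ht.1 hr3.1.le hr3.2.le hη3
    (fun s hs => hu ⟨hs.1, hs.2.trans_lt hr2.2⟩) ((r - t)⁻¹ • fourierL2 (S r - S t))
  rw [hWn r hrm, hWn t htm, hGF t htm, re_inner_fourierL2, re_inner_fourierL2, inner_Pst hSr,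
    inner_Pst hSt, ← fourierL2_sub, re_inner_smul_left, re_inner_self, norm_smul, norm_fourierL2,
    Real.norm_of_nonneg (inv_nonneg.2 hh.le)] at hgi
  have hexp := inner_sqL2_sub_inner_sqL2 hSt hSr
  have hin : inner ℝ (sqL2 (S t)) (S r - S t) =
      inner ℝ (sqL2 (S t)) (S r) - inner ℝ (sqL2 (S t)) (S t) := inner_sub_right _ _ _
  have h1 := real_inner_le_norm (sqL2 (S r) - sqL2 (S t)) (S r - S t)
  have h2 := (abs_le.1 (abs_real_inner_le_norm (sqL2 (S r - S t)) (S r - S t))).1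
  have h0 := mul_nonneg (norm_nonneg (sqL2 (S r - S t))) (norm_nonneg (S r - S t))
  have h3 := mul_le_mul_of_nonneg_right hr1 (norm_nonneg (S r - S t))
  rw [growthNumerator, growthNumerator, integral_detField hSr, integral_detField hSt]
  set N := ‖S r - S t‖ with hN
  set h := r - t with hh'
  have hquad : 2 * (h⁻¹ * N ^ 2) - (h⁻¹ * N) ^ 2 * h = N ^ 2 / h := by
    field_simp
    ring
  -- absorbs the error `η N` of the cubic term into the quadratic rate and the time increment
  have hNh : N ≤ N ^ 2 / h + h := by
    rw [← sub_nonneg]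
    have : N ^ 2 / h + h - N = ((N - h / 2) ^ 2 + 3 / 4 * h ^ 2) / h := by
      field_simp
      ring
    rw [this]
    positivity
  rw [hquad] at hgi
  have hNN : 0 ≤ N ^ 2 / h := by positivity
  have h4 := mul_le_mul_of_nonneg_left hNh hη0.le
  have h5 := mul_le_mul_of_nonneg_right hηε hNN
  have h6 := mul_le_mul_of_nonneg_right hηε hh.le
  linarith

/-! ### Monotonicity from one-sided estimates -/

/-- A continuous function whose lower right Dini derivative is nonnegative is nondecreasing. -/
lemma monotoneOn_of_right_lower_bound {I : Set ℝ} (hI : I.OrdConnected) {f : ℝ → ℝ}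
    (hc : ContinuousOn f I)
    (h : ∀ t ∈ I, ∀ ε > 0, ∀ᶠ r in 𝓝[>] t, -ε * (r - t) ≤ f r - f t) : MonotoneOn f I := by
  intro a ha b hb hab
  have hsub : Set.Icc a b ⊆ I := hI.out ha hb
  have := image_le_of_liminf_slope_right_le_deriv_boundary (f := fun x => -f x) (a := a) (b := b)
    (hc.mono hsub).neg (B := fun _ => -f a) (B' := fun _ => 0) le_rfl continuousOn_const
    (fun x _ => hasDerivWithinAt_const _ _ _) (fun x hx ε hε => ?_) ⟨hab, le_rfl⟩
  · exact neg_le_neg_iff.1 this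
  · refine Eventually.frequently ?_
    filter_upwards [h x (hsub (Set.Ico_subset_Icc_self hx)) (ε / 2) (half_pos hε),
      self_mem_nhdsWithin] with r hr hxr
    have hxr' : 0 < r - x := sub_pos.2 hxr
    rw [slope_def_field, div_lt_iff₀ hxr']
    nlinarith

/-- If `E = y²` satisfies `E' = f + D` with `D ≥ 0`, and `f` grows at least at the rate `6 (y')²`,
then `f / y³` is nondecreasing: formally its derivative is at least
`6 (y')² / y³ - 3 f y' / y⁴ = 3 y' (2 y y' - f) / y⁴ = 3 y' D / y⁴`. -/
lemma monotoneOn_div_cube {I : Set ℝ} (hI : I.OrdConnected) (hIr : ∀ t ∈ I, I ∈ 𝓝[≥] t)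
    {f D y : ℝ → ℝ} (hf : ContinuousOn f I) (hy : ∀ t ∈ I, 0 < y t)
    (hE : ∀ t ∈ I, HasDerivWithinAt (fun t => y t ^ 2) (f t + D t) I t)
    (hD : ∀ t ∈ I, 0 ≤ D t) (hfD : ∀ t ∈ I, 0 ≤ f t + D t)
    (h : ∀ t ∈ I, ∀ ε > 0, ε ≤ 6 → ∀ᶠ r in 𝓝[>] t,
      (6 - ε) * ((y r - y t) ^ 2 / (r - t)) - ε * (r - t) ≤ f r - f t) :
    MonotoneOn (fun t => f t / y t ^ 3) I := by
  have hyd : ∀ t ∈ I, HasDerivWithinAt y ((f t + D t) / (2 * y t)) I t := fun t ht => by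
    have h1 := (hE t ht).sqrt (pow_pos (hy t ht) 2).ne'
    rw [Real.sqrt_sq (hy t ht).le] at h1
    exact h1.congr_of_mem (fun s hs => (Real.sqrt_sq (hy s hs).le).symm) ht
  have hyc : ContinuousOn y I := fun t ht => (hyd t ht).continuousWithinAt
  refine monotoneOn_of_right_lower_bound hI
    (hf.div (hyc.pow 3) fun t ht => (pow_pos (hy t ht) 3).ne') fun t ht η hη => ?_
  have hyt := hy t ht
  set p := (f t + D t) / (2 * y t) with hp
  have hp0 : 0 ≤ p := div_nonneg (hfD t ht) (by linarith)
  have hp2 : 2 * y t * p = f t + D t := by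
    rw [hp]
    field_simp
  have hle : 𝓝[>] t ≤ 𝓝[I] t :=
    (nhdsWithin_mono t Set.Ioi_subset_Ici_self).trans (nhdsWithin_le_iff.2 (hIr t ht))
  have hIgt : ∀ᶠ r in 𝓝[>] t, r ∈ I := hle self_mem_nhdsWithin
  have hsl : ∀ {u : ℝ → ℝ} {u' : ℝ}, HasDerivWithinAt u u' I t →
      Tendsto (fun r => (u r - u t) / (r - t)) (𝓝[>] t) (𝓝 u') := fun {u u'} hu => by
    have h1 := (hasDerivWithinAt_iff_tendsto_slope' Set.self_notMem_Ioi).1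
      (hu.mono_of_mem_nhdsWithin hIgt)
    exact h1.congr fun r => slope_def_field u t r
  have hinv := ((hyd t ht).pow 3).inv (pow_pos hyt 3).ne'
  have hyr : Tendsto y (𝓝[>] t) (𝓝 (y t)) := (hyc t ht).mono_left hle
  obtain ⟨ε, hε0, hε6, hεη⟩ : ∃ ε > 0, ε ≤ 6 ∧ ε * ((p ^ 2 + 1) / y t ^ 3) < η := by
    have hq : 0 < (p ^ 2 + 1) / y t ^ 3 := by positivity
    refine ⟨min 6 (η / (2 * ((p ^ 2 + 1) / y t ^ 3))), by positivity, min_le_left _ _, ?_⟩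
    refine (mul_le_mul_of_nonneg_right (min_le_right _ _) hq.le).trans_lt ?_
    rw [div_mul_eq_mul_div, div_lt_iff₀ (by positivity)]
    nlinarith [mul_pos hη hq]
  -- a lower bound for the difference quotients of `f / y³`, and its limit
  have hlim : Tendsto (fun r => ((6 - ε) * ((y r - y t) / (r - t)) ^ 2 - ε) / y r ^ 3 +
      f t * ((((y ^ 3)⁻¹) r - ((y ^ 3)⁻¹) t) / (r - t))) (𝓝[>] t) (𝓝 _) :=
    ((((hsl (hyd t ht)).pow 2).const_mul (6 - ε)).sub_const ε |>.div (hyr.pow 3)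
      (pow_pos hyt 3).ne').add ((hsl hinv).const_mul (f t))
  have hlt : -η < ((6 - ε) * p ^ 2 - ε) / y t ^ 3 +
      f t * (-(((3 : ℕ) : ℝ) * y t ^ (3 - 1) * p) / (y t ^ 3) ^ 2) := by
    have hid : ((6 - ε) * p ^ 2 - ε) / y t ^ 3 +
        f t * (-(((3 : ℕ) : ℝ) * y t ^ (3 - 1) * p) / (y t ^ 3) ^ 2) =
        3 * p * (2 * y t * p - f t) / y t ^ 4 - ε * ((p ^ 2 + 1) / y t ^ 3) := by
      push_cast
      field_simp
      ring
    have hpos : 0 ≤ 3 * p * (2 * y t * p - f t) / y t ^ 4 := by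
      have : 2 * y t * p - f t = D t := by linarith
      rw [this]
      exact div_nonneg (mul_nonneg (by positivity) (hD t ht)) (by positivity)
    rw [hid]
    linarith
  filter_upwards [hlim.eventually_const_le hlt, h t ht ε hε0 hε6, hIgt, self_mem_nhdsWithin]
    with r hr1 hr2 hrI htr
  have hh : 0 < r - t := sub_pos.2 htr
  have hyr0 := hy r hrI
  simp only [Pi.inv_apply, Pi.pow_apply] at hr1
  have h1 := div_le_div_of_nonneg_right hr2 (pow_pos hyr0 3).le
  have h2 := mul_le_mul_of_nonneg_right hr1 hh.le
  have h3 : (((6 - ε) * ((y r - y t) / (r - t)) ^ 2 - ε) / y r ^ 3 +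
      f t * (((y r ^ 3)⁻¹ - (y t ^ 3)⁻¹) / (r - t))) * (r - t) =
      ((6 - ε) * ((y r - y t) ^ 2 / (r - t)) - ε * (r - t)) / y r ^ 3 +
        f t * ((y r ^ 3)⁻¹ - (y t ^ 3)⁻¹) := by
    field_simp
  rw [h3] at h2
  refine h2.trans ((add_le_add_left h1 _).trans (le_of_eq ?_))
  field_simp
  ring

/-! ### Growth of the enstrophy -/

lemma growthRatio_mul (S : ℝ → MatrixField) {t : ℝ} (ht : S t ≠ 0) :
    growthRatio S t * ‖S t‖ ^ 3 = growthNumerator (S t) :=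
  div_mul_cancel₀ _ (pow_pos (norm_pos_iff.2 ht) 3).ne'

lemma enstrophy_rpow (S : ℝ → MatrixField) (t : ℝ) :
    enstrophy S t ^ (3 / 2 : ℝ) = ‖S t‖ ^ 3 := by
  rw [enstrophy, ← Real.rpow_natCast, ← Real.rpow_mul (norm_nonneg _), ← Real.rpow_natCast]
  norm_num

/-- The functional `-3 ‖S‖²_{Ḣ¹} - 4 ∫ det S` is nondecreasing, being a multiple of the energy of
which the equation is the gradient flow. -/
lemma monotoneOn_growthNumerator {T : EReal} {S : ℝ → MatrixField} (hS : IsMildSolution T S) :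
    MonotoneOn (fun t => growthNumerator (S t)) (timeInterval T) := by
  refine monotoneOn_of_right_lower_bound (ordConnected_timeInterval T)
    (continuousOn_growthNumerator hS.continuous) fun t ht ε hε => ?_
  filter_upwards [eventually_growthNumerator_sub_ge hS ht (ε := min ε 6) (by positivity),
    self_mem_nhdsWithin] with r hr htr
  have hh : 0 < r - t := sub_pos.2 htr
  have h1 : 0 ≤ (6 - min ε 6) * (‖S r - S t‖ ^ 2 / (r - t)) :=
    mul_nonneg (sub_nonneg.2 (min_le_right _ _)) (by positivity)
  have h2 := mul_le_mul_of_nonneg_right (min_le_left ε 6) hh.le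
  linarith

lemma growthNumerator_nonneg {T : EReal} {S : ℝ → MatrixField} (hS : IsMildSolution T S)
    (h0 : S 0 ≠ 0) (hg : 0 ≤ growthRatio S 0) {t : ℝ} (ht : t ∈ timeInterval T) :
    0 ≤ growthNumerator (S t) := by
  have h1 : 0 ≤ growthNumerator (S 0) := by
    rw [← growthRatio_mul S h0]
    positivity
  exact h1.trans (monotoneOn_growthNumerator hS
    (Icc_subset_timeInterval ht ⟨le_rfl, ht.1⟩) ht ht.1)

/-- The enstrophy does not decrease, so the solution cannot vanish. -/
lemma ne_zero_of_growthRatio_nonneg {T : EReal} {S : ℝ → MatrixField} (hS : IsMildSolution T S)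
    (h0 : S 0 ≠ 0) (hg : 0 ≤ growthRatio S 0) {t : ℝ} (ht : t ∈ timeInterval T) : S t ≠ 0 := by
  have h1 : 0 ≤ enstrophy S t - enstrophy S 0 := by
    rw [enstrophy_identity hS ht]
    refine intervalIntegral.integral_nonneg ht.1 fun s hs => ?_
    exact add_nonneg (growthNumerator_nonneg hS h0 hg (Icc_subset_timeInterval ht hs))
      (sq_nonneg _)
  have h2 : 0 < enstrophy S 0 := pow_pos (norm_pos_iff.2 h0) 2
  intro h
  simp only [enstrophy, h, norm_zero] at h1 h2
  linarith

lemma monotoneOn_growthRatio {T : EReal} {S : ℝ → MatrixField} (hS : IsMildSolution T S)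
    (h0 : S 0 ≠ 0) (hg : 0 ≤ growthRatio S 0) : MonotoneOn (growthRatio S) (timeInterval T) := by
  refine monotoneOn_div_cube (f := fun t => growthNumerator (S t))
    (D := fun t => homSobolevNorm 1 (S t) ^ 2) (y := fun t => ‖S t‖)
    (ordConnected_timeInterval T) (fun t ht => timeInterval_mem_nhdsGE ht)
    (continuousOn_growthNumerator hS.continuous)
    (fun t ht => norm_pos_iff.2 (ne_zero_of_growthRatio_nonneg hS h0 hg ht))
    (fun t ht => hasDerivWithinAt_enstrophy hS ht) (fun t _ => sq_nonneg _)
    (fun t ht => add_nonneg (growthNumerator_nonneg hS h0 hg ht) (sq_nonneg _))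
    fun t ht ε hε hε6 => ?_
  filter_upwards [eventually_growthNumerator_sub_ge hS ht hε, self_mem_nhdsWithin] with r hr htr
  have hh : 0 < r - t := sub_pos.2 htr
  have h1 : (‖S r‖ - ‖S t‖) ^ 2 ≤ ‖S r - S t‖ ^ 2 :=
    sq_le_sq.2 (by rw [abs_norm]; exact abs_norm_sub_norm_le _ _)
  have h2 := mul_le_mul_of_nonneg_left (div_le_div_of_nonneg_right h1 hh.le)
    (sub_nonneg.2 hε6)
  linarith

end StrainModel

end

theorem mainTheorem4 (T : EReal) (hT : 0 < T) (S : ℝ → StrainModel.MatrixField)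
    (hS : StrainModel.IsMildSolution T S) (h0 : S 0 ≠ 0)
    (hg : 0 ≤ StrainModel.growthRatio S 0) :
    (∀ t ∈ StrainModel.timeInterval T,
        S t ≠ 0 ∧ MeasureTheory.Integrable (StrainModel.detField (S t))) ∧
      MonotoneOn (StrainModel.growthRatio S) (StrainModel.timeInterval T) ∧
      ∀ t ∈ StrainModel.timeInterval T, ∃ E' : ℝ,
        HasDerivWithinAt (StrainModel.enstrophy S) E' (StrainModel.timeInterval T) t ∧
          StrainModel.growthRatio S 0 * StrainModel.enstrophy S t ^ (3 / 2 : ℝ) ≤ E' := by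
  have hmono := StrainModel.monotoneOn_growthRatio hS h0 hg
  have hne : ∀ t ∈ StrainModel.timeInterval T, S t ≠ 0 := fun t ht =>
    StrainModel.ne_zero_of_growthRatio_nonneg hS h0 hg ht
  refine ⟨fun t ht => ⟨hne t ht, StrainModel.integrable_detField (hS.continuous.1 t ht)⟩, hmono,
    fun t ht => ⟨_, StrainModel.hasDerivWithinAt_enstrophy hS ht, ?_⟩⟩
  have h1 := hmono ⟨le_rfl, by exact_mod_cast hT⟩ ht ht.1
  rw [StrainModel.enstrophy_rpow]
  calc StrainModel.growthRatio S 0 * ‖S t‖ ^ 3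
      ≤ StrainModel.growthRatio S t * ‖S t‖ ^ 3 := by gcongr
    _ = StrainModel.growthNumerator (S t) := StrainModel.growthRatio_mul S (hne t ht)
    _ ≤ _ := le_add_of_nonneg_right (sq_nonneg _)
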